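/- All Lie algebras and modules are finite-dimensional over $\mathbb C$. Let $\mathcal N$ be a nilpotent Lie algebra and let $\mathcal T$ be a maximal torus of $\mathcal N$, that is, an abelian Lie algebra of diagonalizable derivations of $\mathcal N$ that is maximal under inclusion. Put $\mathcal R_{\mathcal T}=\mathcal N\rtimes\mathcal T$. For a $\mathcal T$-module $V$ and $\alpha\in\mathcal T^*$ let $V_\alpha=\{v\in V : t\cdot v=\alpha(t)v \text{ for all } t\in\mathcal T\}$; the weights of $\mathcal T$ on $V$ are the $\alpha$ with $V_\alpha\neq 0$, and $W$ denotes the set of weights of $\mathcal T$ on $\mathcal N$. Assume that (i) $\dim\mathcal T=\dim(\mathcal N/[\mathcal N,\mathcal N])$; (ii) $\dim\mathcal N_\alpha=1$ for every $\alpha\in W$, and $[\mathcal N_\alpha,\mathcal N_\beta]=\mathcal N_{\alpha+\beta}$ whenever $\alpha\ne\beta$ and $\alpha,\beta,\alpha+\beta\in W$. Let $s\ge 2$ and suppose that $\mathcal N$ has nilindex $s+1$, that is, $\mathcal N^{s+1}=0\neq\mathcal N^{s}$, where $\mathcal N^1=\mathcal N$ and $\mathcal N^{k+1}=[\mathcal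 N,\mathcal N^k]$. For an $\mathcal R_{\mathcal T}$-module $\mathcal M$, let $H^k(\mathcal N,\mathcal M)^{\mathcal T}$ be the space of $\mathcal T$-invariant elements of the Chevalley–Eilenberg cohomology $H^k(\mathcal N,\mathcal M)$, where $\mathcal T$ acts on cochains by $$(t\cdot f)(z_1,\dots,z_k)=t\cdot f(z_1,\dots,z_k)-\sum_{l=1}^{k} f(z_1,\dots,[t,z_l],\dots,z_k).$$ (a) If $\mathcal M$ is an $\mathcal R_{\mathcal T}$-module on which $\mathcal T$ acts diagonally and all of whose $\mathcal T$-weights lie in $W$, then $H^s(\mathcal N,\mathcal M)^{\mathcal T}=0$. (b) If $H^i(\mathcal R_{\mathcal T},\mathcal R_{\mathcal T})=0$ for all $0\le i\le s-1$ (adjoint coefficients), then $H^j(\mathcal N,\mathcal R_{\mathcal T})^{\mathcal T}=0$ for all $j\ge 0$ and $H^n(\mathcal R_{\mathcal T},\mathcal R_{\mathcal T})=0$ for all $n\ge 0$. -/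

import Mathlib

noncomputable section

namespace MaxRank

-- The commutator bracket makes `Module.End ℂ M` a Lie algebra.
attribute [local instance 100] LieRing.ofAssociativeRing

/-! ### Chevalley-Eilenberg cohomology

A `k`-cochain of `L` with values in `M` is an alternating `k`-linear map `L [⋀^Fin k]→ₗ[ℂ] M`, and
the module structure on `M` is given by a representation `ρ : L →ₗ⁅ℂ⁆ Module.End ℂ M`. -/

section Cohomology

variable {L M : Type*} [LieRing L] [LieAlgebra ℂ L] [AddCommGroup M] [Module ℂ M]

/-- The bilinear map `(x, y) ↦ f(⁅x, y⁆, …)` attached to a cochain `f`. -/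
def bracketInsert {m : ℕ} (f : L [⋀^Fin (m + 1)]→ₗ[ℂ] M) : L →ₗ[ℂ] L →ₗ[ℂ] L [⋀^Fin m]→ₗ[ℂ] M :=
  (LieModule.toEnd ℂ L L : L →ₗ[ℂ] L →ₗ[ℂ] L).compr₂ f.curryLeft

/-- The value at `x` of the second sum in the Chevalley-Eilenberg differential,
`∑_{i < j} (-1)^(i+j) f(⁅x i, x j⁆, …, omit x i, …, omit x j, …)`.
Here `i.castSucc` is the index `i` seen in the larger index set, and after `x j` has been
removed, `x i` (with `i < j`) still stands in position `i`. -/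
def bracketSum {m : ℕ} (f : L [⋀^Fin (m + 1)]→ₗ[ℂ] M) (x : Fin (m + 2) → L) : M :=
  ∑ j : Fin (m + 2), ∑ i : Fin (m + 1), if i.castSucc < j then
    (-1 : ℂ) ^ ((i : ℕ) + (j : ℕ)) • f (Fin.cons ⁅x i.castSucc, x j⁆ (i.removeNth (j.removeNth x)))
  else 0

/-- The sum over `i < j` is, up to a factor, a double alternatization; so it is alternating. -/
theorem bracketSum_eq {m : ℕ} (f : L [⋀^Fin (m + 1)]→ₗ[ℂ] M) (x : Fin (m + 2) → L) :
    bracketSum f x = ((-1 / 2 : ℂ) • AlternatingMap.alternatizeUncurryFin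
      (AlternatingMap.alternatizeUncurryFinLM ∘ₗ bracketInsert f)) x := by
  have hval : ∀ (x y : L) (v : Fin m → L), bracketInsert f x y v = f (Fin.cons ⁅x, y⁆ v) :=
    fun _ _ _ => rfl
  rw [AlternatingMap.smul_apply,
    AlternatingMap.alternatizeUncurryFin_alternatizeUncurryFinLM_comp_apply, bracketSum,
    Fin.sum_univ_succ]
  simp only [Fin.not_lt_zero, if_false, Finset.sum_const_zero, zero_add]
  rw [Finset.sum_comm, Finset.smul_sum]
  refine Finset.sum_congr rfl fun i _ => ?_
  rw [Finset.smul_sum, ← Finset.sum_filter]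
  have hfil : (Finset.univ.filter fun j : Fin (m + 1) => i.castSucc < j.succ) = Finset.Ici i :=
    Finset.ext fun j => by
      rw [Finset.mem_filter, Finset.mem_Ici, Fin.lt_def, Fin.le_def, Fin.val_castSucc,
        Fin.val_succ, Nat.lt_succ_iff]
      exact and_iff_right (Finset.mem_univ j)
  rw [hfil]
  refine Finset.sum_congr rfl fun j hj => ?_
  rw [Finset.mem_Ici] at hj
  have hrem : i.removeNth (j.succ.removeNth x) = j.removeNth (i.castSucc.removeNth x) := by
    rw [Fin.removeNth_removeNth_eq_swap]
    simp [Fin.predAbove, hj, Fin.succAbove]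
  have hskew : f (Fin.cons ⁅x j.succ, x i.castSucc⁆ (j.removeNth (i.castSucc.removeNth x)))
      = - f (Fin.cons ⁅x i.castSucc, x j.succ⁆ (j.removeNth (i.castSucc.removeNth x))) := by
    rw [← lie_skew]
    exact congrArg (fun g => g (j.removeNth (i.castSucc.removeNth x)))
      (map_neg f.curryLeft ⁅x i.castSucc, x j.succ⁆)
  rw [hval, hval, hrem, hskew, ← Int.cast_smul_eq_zsmul ℂ]
  simp only [Fin.val_succ, ← add_assoc, pow_succ]
  push_cast
  module

/-- The second sum in the differential, as an alternating map. It is empty in degree `0`. -/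
def bracketPart : {k : ℕ} → (L [⋀^Fin k]→ₗ[ℂ] M) → L [⋀^Fin (k + 1)]→ₗ[ℂ] M
  | 0, _ => 0
  | _ + 1, f =>
    { toFun := bracketSum f
      map_update_add' := fun v i x y => by simp only [bracketSum_eq, AlternatingMap.map_update_add]
      map_update_smul' := fun v i c x => by
        simp only [bracketSum_eq, AlternatingMap.map_update_smul]
      map_eq_zero_of_eq' := fun v i j h hij => by
        simp only [bracketSum_eq]; exact AlternatingMap.map_eq_zero_of_eq _ v h hij }

/-- The linear map `x ↦ x · f(…)` attached to a cochain `f`. -/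
def actionInsert (ρ : L →ₗ⁅ℂ⁆ Module.End ℂ M) {k : ℕ} (f : L [⋀^Fin k]→ₗ[ℂ] M) :
    L →ₗ[ℂ] L [⋀^Fin k]→ₗ[ℂ] M where
  toFun x := (ρ x).compAlternatingMap f
  map_add' x y := by ext v; simp
  map_smul' c x := by ext v; simp

/-- The Chevalley-Eilenberg differential `d : C^k(L, M) → C^(k+1)(L, M)`. The first summand is
`∑ i, (-1)^i x i · f(…, omit x i, …)`; indices start from `0`. -/
def differential (ρ : L →ₗ⁅ℂ⁆ Module.End ℂ M) (k : ℕ) :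
    (L [⋀^Fin k]→ₗ[ℂ] M) →ₗ[ℂ] L [⋀^Fin (k + 1)]→ₗ[ℂ] M where
  toFun f := AlternatingMap.alternatizeUncurryFin (actionInsert ρ f) + bracketPart f
  map_add' f g := by
    ext x
    have h : bracketPart (f + g) x = bracketPart f x + bracketPart g x := by
      cases k with
      | zero => simp [bracketPart]
      | succ m =>
        simp only [bracketPart, AlternatingMap.coe_mk, MultilinearMap.coe_mk, bracketSum,
          ← Finset.sum_add_distrib]
        refine Finset.sum_congr rfl fun j _ => Finset.sum_congr rfl fun i _ => ?_
        split_ifs <;> simp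
    simp only [AlternatingMap.add_apply, AlternatingMap.alternatizeUncurryFin_apply, h]
    simp only [actionInsert, LinearMap.coe_mk, AddHom.coe_mk,
      LinearMap.compAlternatingMap_apply, AlternatingMap.add_apply, map_add, smul_add,
      Finset.sum_add_distrib]
    abel
  map_smul' c f := by
    ext x
    have h : bracketPart (c • f) x = c • bracketPart f x := by
      cases k with
      | zero => simp [bracketPart]
      | succ m =>
        simp only [bracketPart, AlternatingMap.coe_mk, MultilinearMap.coe_mk, bracketSum,
          Finset.smul_sum]
        refine Finset.sum_congr rfl fun j _ => Finset.sum_congr rfl fun i _ => ?_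
        split_ifs <;> simp [smul_comm c]
    simp only [AlternatingMap.add_apply, AlternatingMap.alternatizeUncurryFin_apply, h,
      AlternatingMap.smul_apply, RingHom.id_apply, smul_add]
    simp only [actionInsert, LinearMap.coe_mk, AddHom.coe_mk,
      LinearMap.compAlternatingMap_apply, AlternatingMap.smul_apply, map_smul, Finset.smul_sum,
      smul_comm c]

theorem differential_zero_apply (ρ : L →ₗ⁅ℂ⁆ Module.End ℂ M) (f : L [⋀^Fin 0]→ₗ[ℂ] M)
    (x : Fin 1 → L) : differential ρ 0 f x = ρ (x 0) (f ![]) := by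
  simp only [differential, LinearMap.coe_mk, AddHom.coe_mk,
    AlternatingMap.alternatizeUncurryFin_apply, bracketPart, add_zero,
    actionInsert, LinearMap.compAlternatingMap_apply]
  simp [Matrix.empty_eq]

theorem differential_succ_apply (ρ : L →ₗ⁅ℂ⁆ Module.End ℂ M) (m : ℕ)
    (f : L [⋀^Fin (m + 1)]→ₗ[ℂ] M) (x : Fin (m + 2) → L) :
    differential ρ (m + 1) f x =
      ∑ i : Fin (m + 2), (-1 : ℂ) ^ (i : ℕ) • ρ (x i) (f (i.removeNth x)) +
      ∑ j : Fin (m + 2), ∑ i : Fin (m + 1), if i.castSucc < j then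
        (-1 : ℂ) ^ ((i : ℕ) + (j : ℕ)) •
          f (Fin.cons ⁅x i.castSucc, x j⁆ (i.removeNth (j.removeNth x)))
      else 0 := by
  have h : ∀ (n : ℕ) (v : M), ((-1 : ℤ) ^ n) • v = ((-1 : ℂ) ^ n) • v := fun n v => by
    rw [← Int.cast_smul_eq_zsmul ℂ]; push_cast; rfl
  simp only [differential, LinearMap.coe_mk, AddHom.coe_mk, AlternatingMap.add_apply,
    AlternatingMap.alternatizeUncurryFin_apply, h]
  rfl

/-- The cocycles `Z^k = ker d^k`. -/
def cocycles (ρ : L →ₗ⁅ℂ⁆ Module.End ℂ M) (k : ℕ) : Submodule ℂ (L [⋀^Fin k]→ₗ[ℂ] M) :=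
  LinearMap.ker (differential ρ k)

/-- The coboundaries `B^k = im d^(k-1)`, with `B^0 = 0`. -/
def coboundaries (ρ : L →ₗ⁅ℂ⁆ Module.End ℂ M) : (k : ℕ) → Submodule ℂ (L [⋀^Fin k]→ₗ[ℂ] M)
  | 0 => ⊥
  | k + 1 => LinearMap.range (differential ρ k)

/-- The cohomology `H^k = Z^k / B^k`. -/
abbrev Cohomology (ρ : L →ₗ⁅ℂ⁆ Module.End ℂ M) (k : ℕ) : Type _ :=
  cocycles ρ k ⧸ (coboundaries ρ k).submoduleOf (cocycles ρ k)

/-- `f(v 0, …, D (v s), …, v (k-1))` is multilinear in `v`. -/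
theorem update_eq_compLinearMap {k : ℕ} (f : L [⋀^Fin k]→ₗ[ℂ] M) (D : Module.End ℂ L) (s : Fin k)
    (v : Fin k → L) : f (Function.update v s (D (v s))) =
      f.toMultilinearMap.compLinearMap (fun i => if i = s then D else LinearMap.id) v := by
  rw [MultilinearMap.compLinearMap_apply]
  refine congrArg f (funext fun i => ?_)
  by_cases h : i = s
  · subst h; simp
  · simp [h]

/-- Given an endomorphism `D` of `L` and an endomorphism `E` of `M`, the endomorphism
`f ↦ (v ↦ E (f v) - ∑ s, f(v 0, …, D (v s), …, v (k-1)))` of the space of `k`-cochains. -/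
def cochainAction (D : Module.End ℂ L) (E : Module.End ℂ M) (k : ℕ) :
    (L [⋀^Fin k]→ₗ[ℂ] M) →ₗ[ℂ] L [⋀^Fin k]→ₗ[ℂ] M where
  toFun f :=
    { toFun := fun v => E (f v) - ∑ s : Fin k, f (Function.update v s (D (v s)))
      map_update_add' := fun v i x y => by
        simp only [update_eq_compLinearMap, MultilinearMap.map_update_add,
          AlternatingMap.map_update_add, map_add, Finset.sum_add_distrib]
        abel
      map_update_smul' := fun v i c x => by
        simp only [update_eq_compLinearMap, MultilinearMap.map_update_smul,
          AlternatingMap.map_update_smul, map_smul, ← Finset.smul_sum, smul_sub]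
      map_eq_zero_of_eq' := fun v i j h hij => by
        have hsum : ∑ s : Fin k, f (Function.update v s (D (v s))) =
            f (Function.update v i (D (v i))) + f (Function.update v j (D (v j))) := by
          refine Fintype.sum_eq_add i j hij fun s hs => ?_
          refine f.map_eq_zero_of_eq _ ?_ hij
          rw [Function.update_of_ne hs.1.symm, Function.update_of_ne hs.2.symm, h]
        have hswap : Function.update v j (D (v j)) =
            Function.update v i (D (v i)) ∘ Equiv.swap i j := by
          funext l
          by_cases hl : l = j
          · subst hl; simp [h]
          · by_cases hi : l = i
            · subst hi; simp [hl, h, Function.update_of_ne hij.symm]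
            · simp [hl, hi, Equiv.swap_apply_of_ne_of_ne]
        rw [hsum, hswap, f.map_swap _ hij, f.map_eq_zero_of_eq v h hij]
        simp }
  map_add' f g := by
    ext v
    simp [Finset.sum_add_distrib]
    abel
  map_smul' c f := by
    ext v
    simp [Finset.smul_sum, smul_sub]

end Cohomology

/-! ### Solvable Lie algebras of maximal rank -/

section Torus

/-- The space of vectors of weight `α` for a linear family `θ` of endomorphisms. -/
def weightSpace {T V : Type*} [AddCommGroup T] [Module ℂ T] [AddCommGroup V] [Module ℂ V]
    (θ : T →ₗ[ℂ] Module.End ℂ V) (α : Module.Dual ℂ T) : Submodule ℂ V :=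
  ⨅ t : T, (θ t).eigenspace (α t)

/-- The set of weights: the linear forms whose weight space is nonzero. -/
def weights {T V : Type*} [AddCommGroup T] [Module ℂ T] [AddCommGroup V] [Module ℂ V]
    (θ : T →ₗ[ℂ] Module.End ℂ V) : Set (Module.Dual ℂ T) :=
  {α | weightSpace θ α ≠ ⊥}

/-- The family of endomorphisms acts diagonally: `V` is the sum of its weight spaces. -/
def ActsDiagonally {T V : Type*} [AddCommGroup T] [Module ℂ T] [AddCommGroup V] [Module ℂ V]
    (θ : T →ₗ[ℂ] Module.End ℂ V) : Prop :=
  ⨆ α : Module.Dual ℂ T, weightSpace θ α = ⊤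

variable {N : Type*} [LieRing N] [LieAlgebra ℂ N]

/-- The nilindex of a nilpotent Lie algebra: the least `k ≥ 1` with `N^k = 0`, where `N^1 = N` and
`N^(k+1) = [N, N^k]`. Mathlib's `nilpotencyLength` numbers the same series from `N^0 = N`. -/
def nilindex (N : Type*) [LieRing N] : ℕ :=
  LieModule.nilpotencyLength N N + 1

/-- A torus of `N`: an abelian Lie algebra of diagonalizable derivations of `N`. -/
def IsTorus (T : LieSubalgebra ℂ (LieDerivation ℂ N N)) : Prop :=
  (∀ D ∈ T, ∀ E ∈ T, ⁅D, E⁆ = 0) ∧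
    ∀ D ∈ T, ⨆ μ : ℂ, Module.End.eigenspace (D : N →ₗ[ℂ] N) μ = ⊤

/-- A torus that is maximal under inclusion. -/
def IsMaximalTorus (T : LieSubalgebra ℂ (LieDerivation ℂ N N)) : Prop :=
  Maximal IsTorus T

variable (T : LieSubalgebra ℂ (LieDerivation ℂ N N))

/-- The semidirect product `R_T = N ⋊ T`. -/
abbrev Extension : Type _ := LieAlgebra.SemiDirectSum N T T.incl

/-- The action of `T` on `N` by derivations. -/
def torusOnN : T →ₗ[ℂ] Module.End ℂ N :=
  (LieDerivation.toLinearMapLieHom ℂ N : LieDerivation ℂ N N →ₗ[ℂ] Module.End ℂ N) ∘ₗ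
    (T.incl : T →ₗ[ℂ] LieDerivation ℂ N N)

variable (M : Type*) [AddCommGroup M] [Module ℂ M] [LieRingModule (Extension T) M]
  [LieModule ℂ (Extension T) M]

/-- The action of `N` on an `R_T`-module. -/
def nilOnModule : N →ₗ⁅ℂ⁆ Module.End ℂ M :=
  (LieModule.toEnd ℂ (Extension T) M).comp (LieAlgebra.SemiDirectSum.inl T.incl)

/-- The action of `T` on an `R_T`-module. -/
def torusOnModule : T →ₗ[ℂ] Module.End ℂ M :=
  (LieModule.toEnd ℂ (Extension T) M : Extension T →ₗ[ℂ] Module.End ℂ M) ∘ₗ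
    (LieAlgebra.SemiDirectSum.inr T.incl : T →ₗ[ℂ] Extension T)

/-- The `T`-invariants `H^k(N, M)^T` of `H^k(N, M)`: the classes of the cocycles `f` such that
`t · f` is a coboundary for every `t ∈ T`, where
`(t · f)(z_1, …, z_k) = t · f(z_1, …, z_k) - ∑ s, f(z_1, …, [t, z_s], …, z_k)`. -/
def invariantCohomology (k : ℕ) : Submodule ℂ (Cohomology (nilOnModule T M) k) :=
  Submodule.map (Submodule.mkQ _) <| Submodule.comap (Submodule.subtype _) <|
    ⨅ t : T, (coboundaries (nilOnModule T M) k).comap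
      (cochainAction (torusOnN T t) (torusOnModule T M t) k)

end Torus

end MaxRank

end

/-!
# Vanishing of invariant cohomology for solvable Lie algebras of maximal rank

*Weights and degrees.* Since `dim T = dim N/[N,N]`, weight vectors `e i` can be chosen that map to
a basis of `N/[N,N]`; they generate `N`, so `T` embeds into the diagonal matrices on their span,
and by equality of dimensions every choice of values for the weights `α i` of the `e i` is taken at
some element of `T` (`IsTorus.exists_isWeightGenerating`). The right-normed brackets of the `e i`
are weight vectors spanning `N`; hence every weight of `N` is a sum of `α i`'s whose number of
summands, the degree, lies between `1` and `s`, and the degree is additive. This is where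
nilpotency enters.

*Degrees `k ≥ s`.* A `T`-invariant cochain `f` maps weight vectors of weights `β₁, …, βₖ` to a
vector of weight `β₁ + ⋯ + βₖ`, of degree at least `k`. If all weights of `M` are weights of `N`,
or zero, this forces `f = 0` for `k > s`, and for `k = s` it forces `f` to be determined by its
values on tuples of the `e i`. In that case `f` is a coboundary, cocycle or not
(`IsWeightGenerating.mem_coboundaries`): if `f (e ∘ a) ≠ 0`, then `∑ k, α (a k)` is the weight of a
nonzero iterated bracket, whose innermost bracket `⁅e i, e j⁆` is nonzero with `i`, `j` in the
range of `a`. Let `ψ` be a functional on `N` that is `1` on `⁅e i, e j⁆` and vanishes on all weight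
spaces of weight other than `α i + α j`. Adding `d (ψ ∧ f(e i, e j, …))` to `f` kills its values on
tuples containing `i` and `j` and changes no others; iteration reaches `0`.

*Degrees `k < s`.* In the style of Hochschild and Serre, an invariant cocycle of `N` pulls back
along the linear projection `N ⋊ T → N` to a cocycle of `N ⋊ T`, so that `H^k(N ⋊ T, M) = 0`
implies `H^k(N, M)^T = 0` (`invariant_cocycle_mem_coboundaries`). Conversely, if all `H^k(N, M)^T`
vanish, then so do all `H^n(N ⋊ T, M)` (`subsingleton_cohomology_extension`): a cocycle may be
taken invariant under `T`, and by induction on `n` its components `τ ∧ i_t f` along `T` are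
coboundaries; what remains is the pullback of an invariant cocycle of `N`.

All identities for the differential are derived from Cartan's formula `i_x d + d i_x = L_x`
(`contract_differential`), where the contraction `i_x f` is `f.curryLeft x` and the Lie derivative
`L_x` is `cochainAction (ad x) (ρ x)`. The passage from invariant classes to invariant cochains
rests on the semisimplicity of the action of `T` on cochains.
-/

noncomputable section

namespace MaxRank

attribute [local instance 100] LieRing.ofAssociativeRing

/-! ### Cartan calculus on Chevalley-Eilenberg cochains -/

section Cartan

variable {L M : Type*} [LieRing L] [LieAlgebra ℂ L] [AddCommGroup M] [Module ℂ M]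

theorem cochain_ext {k : ℕ} {f g : L [⋀^Fin (k + 1)]→ₗ[ℂ] M}
    (h : ∀ x, f.curryLeft x = g.curryLeft x) : f = g := by
  ext v
  have := congrArg (fun u => u (Fin.tail v)) (h (v 0))
  simpa [AlternatingMap.curryLeft_apply_apply, Matrix.vecCons, Fin.cons_self_tail] using this

theorem contract_contract {k : ℕ} (f : L [⋀^Fin (k + 2)]→ₗ[ℂ] M) (x y : L) :
    (f.curryLeft x).curryLeft y = -(f.curryLeft y).curryLeft x := by
  have h := AlternatingMap.curryLeft_same f (x + y)
  have hx := AlternatingMap.curryLeft_same f x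
  have hy := AlternatingMap.curryLeft_same f y
  simp only [map_add, LinearMap.add_apply, AlternatingMap.curryLeft_add, hx, hy] at h
  rw [eq_neg_iff_add_eq_zero, add_comm]
  simpa using h

theorem cochainAction_apply (D : Module.End ℂ L) (E : Module.End ℂ M) {k : ℕ}
    (f : L [⋀^Fin k]→ₗ[ℂ] M) (v : Fin k → L) :
    cochainAction D E k f v = E (f v) - ∑ s : Fin k, f (Function.update v s (D (v s))) := rfl

theorem contract_cochainAction (D : Module.End ℂ L) (E : Module.End ℂ M) {k : ℕ}
    (f : L [⋀^Fin (k + 1)]→ₗ[ℂ] M) (x : L) :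
    (cochainAction D E (k + 1) f).curryLeft x =
      cochainAction D E k (f.curryLeft x) - f.curryLeft (D x) := by
  ext v
  simp only [AlternatingMap.curryLeft_apply_apply, cochainAction_apply, AlternatingMap.sub_apply,
    Fin.sum_univ_succ, Matrix.vecCons, Fin.cons_zero, Fin.cons_succ, Fin.update_cons_zero,
    Fin.cons_update]
  abel

theorem contract_differential_zero (ρ : L →ₗ⁅ℂ⁆ Module.End ℂ M) (f : L [⋀^Fin 0]→ₗ[ℂ] M) (x : L) :
    (differential ρ 0 f).curryLeft x = cochainAction (LieModule.toEnd ℂ L L x) (ρ x) 0 f := by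
  ext v
  rw [AlternatingMap.curryLeft_apply_apply, differential_zero_apply, cochainAction_apply]
  simp [Subsingleton.elim v ![]]

/-- Cartan's formula `i_x d f = L_x f - d i_x f`. Together with its version in degree `0` it
determines the differential recursively. -/
theorem contract_differential (ρ : L →ₗ⁅ℂ⁆ Module.End ℂ M) {k : ℕ} (f : L [⋀^Fin (k + 1)]→ₗ[ℂ] M)
    (x : L) : (differential ρ (k + 1) f).curryLeft x =
      cochainAction (LieModule.toEnd ℂ L L x) (ρ x) (k + 1) f
        - differential ρ k (f.curryLeft x) := by
  ext v
  have hins : ∀ (j : Fin (k + 1)) (y : L), f (Function.update v j y) =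
      (-1 : ℂ) ^ (j : ℕ) • f (Fin.cons y (j.removeNth v)) := fun j y => by
    have := f.map_insertNth j y (j.removeNth v)
    rw [Fin.insertNth_removeNth] at this
    rw [this, ← Int.cast_smul_eq_zsmul ℂ]
    push_cast; rfl
  have hz : ∑ i : Fin (k + 1), (if Fin.castSucc i < (0 : Fin (k + 2)) then
      (-1 : ℂ) ^ ((i : ℕ) + ((0 : Fin (k + 2)) : ℕ)) • f (Fin.cons
        ⁅(Fin.cons x v : Fin (k + 2) → L) i.castSucc, (Fin.cons x v : Fin (k + 2) → L) 0⁆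
        (i.removeNth ((0 : Fin (k + 2)).removeNth (Fin.cons x v : Fin (k + 2) → L)))) else 0)
        = 0 := by simp
  rw [AlternatingMap.curryLeft_apply_apply, AlternatingMap.sub_apply, cochainAction_apply,
    differential_succ_apply, Matrix.vecCons, Fin.sum_univ_succ (n := k + 1),
    Fin.sum_univ_succ (n := k + 1), hz]
  have hfirst : ∑ j : Fin (k + 1), f (Function.update v j ⁅x, v j⁆) =
      ∑ j : Fin (k + 1), (-1 : ℂ) ^ (j : ℕ) • f (Fin.cons ⁅x, v j⁆ (j.removeNth v)) :=
    Finset.sum_congr rfl fun j _ => hins j _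
  simp only [LieModule.toEnd_apply_apply]
  rw [hfirst]
  have hrem : ∀ j : Fin (k + 1), (0 : Fin (k + 1)).removeNth
      (j.succ.removeNth (Fin.cons x v : Fin (k + 2) → L)) = j.removeNth v := fun j => by
    ext i; simp [Fin.removeNth]
  -- In the inner sum, `i = 0` gives the term of `L_x` with `⁅x, v j⁆`, and the other `i` give
  -- terms of the differential of `i_x f`.
  have hinner : ∀ j : Fin (k + 1), (∑ i : Fin (k + 1), if i.castSucc < j.succ then
      (-1 : ℂ) ^ ((i : ℕ) + ((j.succ : Fin (k + 2)) : ℕ)) • f (Fin.cons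
        ⁅(Fin.cons x v : Fin (k + 2) → L) i.castSucc, (Fin.cons x v : Fin (k + 2) → L) j.succ⁆
        (i.removeNth (j.succ.removeNth (Fin.cons x v : Fin (k + 2) → L)))) else 0) =
      -((-1 : ℂ) ^ (j : ℕ) • f (Fin.cons ⁅x, v j⁆ (j.removeNth v))) +
      ∑ i : Fin k, if i.castSucc < j then (-1 : ℂ) ^ ((i : ℕ) + (j : ℕ)) • f (Fin.cons
        ⁅v i.castSucc, v j⁆ (i.succ.removeNth (j.succ.removeNth (Fin.cons x v : Fin (k + 2) → L))))
        else 0 := fun j => by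
    rw [Fin.sum_univ_succ, hrem]
    congr 1
    · simp [pow_succ]
    · refine Finset.sum_congr rfl fun i _ => ?_
      simp only [Fin.castSucc_succ, Fin.succ_lt_succ_iff, Fin.cons_succ, Fin.val_succ]
      congr 2
      ring
  have hsign : ∀ (i : ℕ) (m : M), (-1 : ℂ) ^ (i + 1) • m = -((-1 : ℂ) ^ i • m) := fun i m => by
    simp [pow_succ]
  rw [Finset.sum_congr rfl fun j _ => hinner j]
  simp only [Fin.cons_zero, Fin.cons_succ, Fin.val_zero, pow_zero, one_smul, Fin.val_succ,
    Fin.removeNth_zero, Fin.tail_cons, zero_add, Finset.sum_add_distrib, Finset.sum_neg_distrib,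
    hsign]
  cases k with
  | zero =>
    rw [differential_zero_apply, AlternatingMap.curryLeft_apply_apply]
    have h0 : Fin.succ 0 = (1 : Fin 2) := rfl
    have h1 : (1 : Fin 2).removeNth (Fin.cons x v : Fin 2 → L) = ![x] := by
      ext i; fin_cases i; rfl
    simp [h0, h1]
    abel
  | succ m =>
    rw [differential_succ_apply]
    have hswap : ∀ (y : L) (w : Fin m → L), f (Fin.cons y (Fin.cons x w)) =
        - f (Fin.cons x (Fin.cons y w)) := fun y w =>
      congrArg (fun u => u w) (contract_contract f y x)
    have hr : ∀ (n : ℕ) (j : Fin (n + 1)) (w : Fin (n + 1) → L), j.succ.removeNth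
      (Fin.cons x w : Fin (n + 2) → L) = Fin.cons x (j.removeNth w) := fun n j w => by
      ext i; cases i using Fin.cases <;> simp [Fin.removeNth]
    simp only [AlternatingMap.curryLeft_apply_apply, hr, hswap, Matrix.vecCons, smul_neg]
    have : ∀ (p : Prop) [Decidable p] (y : M), (if p then - y else 0) = - (if p then y else 0) := by
      intros; split_ifs <;> simp
    simp only [this, Finset.sum_neg_distrib]
    abel

theorem contract_sub {k : ℕ} (f g : L [⋀^Fin (k + 1)]→ₗ[ℂ] M) (x : L) :
    (f - g).curryLeft x = f.curryLeft x - g.curryLeft x := rfl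

theorem contract_neg {k : ℕ} (f : L [⋀^Fin (k + 1)]→ₗ[ℂ] M) (x : L) :
    (-f).curryLeft x = -f.curryLeft x := rfl

theorem contract_smul {k : ℕ} (c : ℂ) (f : L [⋀^Fin (k + 1)]→ₗ[ℂ] M) (x : L) :
    (c • f).curryLeft x = c • f.curryLeft x := rfl

theorem cochainAction_lie (D D' : Module.End ℂ L) (E E' : Module.End ℂ M) {k : ℕ}
    (f : L [⋀^Fin k]→ₗ[ℂ] M) :
    cochainAction D E k (cochainAction D' E' k f) - cochainAction D' E' k (cochainAction D E k f) =
      cochainAction (D * D' - D' * D) (E * E' - E' * E) k f := by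
  induction k with
  | zero => ext v; simp [cochainAction_apply]
  | succ k ih =>
    refine cochain_ext fun x => ?_
    simp only [contract_sub, contract_cochainAction, map_sub, ← ih, LinearMap.sub_apply,
      Module.End.mul_apply]
    abel

theorem cochainAction_add (D D' : Module.End ℂ L) (E E' : Module.End ℂ M) (k : ℕ) :
    cochainAction (D + D') (E + E') k = cochainAction D E k + cochainAction D' E' k := by
  ext f v
  simp [cochainAction_apply, Finset.sum_add_distrib]
  abel

theorem cochainAction_smul (c : ℂ) (D : Module.End ℂ L) (E : Module.End ℂ M) (k : ℕ) :
    cochainAction (c • D) (c • E) k = c • cochainAction D E k := by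
  ext f v
  simp [cochainAction_apply, Finset.smul_sum, smul_sub]

/-- If `D` is a derivation of `L` and `E` is compatible with it, then the induced action on cochains
commutes with the differential. -/
theorem cochainAction_differential (ρ : L →ₗ⁅ℂ⁆ Module.End ℂ M) (D : Module.End ℂ L)
    (E : Module.End ℂ M) (hD : ∀ x y, D ⁅x, y⁆ = ⁅D x, y⁆ + ⁅x, D y⁆)
    (hE : ∀ x m, E (ρ x m) = ρ (D x) m + ρ x (E m)) {k : ℕ} (f : L [⋀^Fin k]→ₗ[ℂ] M) :
    cochainAction D E (k + 1) (differential ρ k f) = differential ρ k (cochainAction D E k f) := by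
  have key : ∀ (k : ℕ) (f : L [⋀^Fin k]→ₗ[ℂ] M) (y : L),
      cochainAction (LieModule.toEnd ℂ L L (D y)) (ρ (D y)) k f =
        cochainAction D E k (cochainAction (LieModule.toEnd ℂ L L y) (ρ y) k f) -
        cochainAction (LieModule.toEnd ℂ L L y) (ρ y) k (cochainAction D E k f) := fun k f y => by
    rw [cochainAction_lie]
    congr 2
    · ext x; simp [hD]
    · ext m; simp [hE]
  induction k with
  | zero =>
    refine cochain_ext fun y => ?_
    rw [contract_cochainAction, contract_differential_zero, contract_differential_zero,
      contract_differential_zero, key]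
    abel
  | succ k ih =>
    refine cochain_ext fun y => ?_
    rw [contract_cochainAction, contract_differential, contract_differential,
      contract_differential, key, contract_cochainAction, map_sub, map_sub, ih]
    abel

/-- The Lie derivative `L_x` commutes with the differential. -/
theorem cochainAction_toEnd_differential (ρ : L →ₗ⁅ℂ⁆ Module.End ℂ M) (x : L) {k : ℕ}
    (f : L [⋀^Fin k]→ₗ[ℂ] M) :
    cochainAction (LieModule.toEnd ℂ L L x) (ρ x) (k + 1) (differential ρ k f) =
      differential ρ k (cochainAction (LieModule.toEnd ℂ L L x) (ρ x) k f) :=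
  cochainAction_differential ρ _ _ (fun y z => by simp) (fun y m => by
    rw [LieModule.toEnd_apply_apply, LieHom.map_lie, LieRing.of_associative_ring_bracket]
    simp) f

theorem differential_differential (ρ : L →ₗ⁅ℂ⁆ Module.End ℂ M) {k : ℕ} (f : L [⋀^Fin k]→ₗ[ℂ] M) :
    differential ρ (k + 1) (differential ρ k f) = 0 := by
  induction k with
  | zero =>
    refine cochain_ext fun y => ?_
    rw [contract_differential, contract_differential_zero, cochainAction_toEnd_differential,
      sub_self]; rfl
  | succ k ih =>
    refine cochain_ext fun y => ?_
    rw [contract_differential, contract_differential, cochainAction_toEnd_differential, map_sub,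
      ih, sub_zero, sub_self]; rfl

/-- The exterior product `τ ∧ f` of a linear form and a cochain,
`(τ ∧ f)(v) = ∑ i, (-1)^i τ(v i) f(…, omit v i, …)`. -/
def wedge (τ : L →ₗ[ℂ] ℂ) {k : ℕ} (f : L [⋀^Fin k]→ₗ[ℂ] M) : L [⋀^Fin (k + 1)]→ₗ[ℂ] M :=
  AlternatingMap.alternatizeUncurryFin (τ.smulRight f)

theorem wedge_apply (τ : L →ₗ[ℂ] ℂ) {k : ℕ} (f : L [⋀^Fin k]→ₗ[ℂ] M) (v : Fin (k + 1) → L) :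
    wedge τ f v = ∑ i : Fin (k + 1), (-1 : ℂ) ^ (i : ℕ) • τ (v i) • f (i.removeNth v) := by
  rw [wedge, AlternatingMap.alternatizeUncurryFin_apply]
  refine Finset.sum_congr rfl fun i _ => ?_
  rw [← Int.cast_smul_eq_zsmul ℂ]
  push_cast; rfl

theorem wedge_sub (τ : L →ₗ[ℂ] ℂ) {k : ℕ} (f g : L [⋀^Fin k]→ₗ[ℂ] M) :
    wedge τ (f - g) = wedge τ f - wedge τ g := by
  ext v; simp [wedge_apply, smul_sub]

theorem contract_wedge_zero (τ : L →ₗ[ℂ] ℂ) (f : L [⋀^Fin 0]→ₗ[ℂ] M) (x : L) :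
    (wedge τ f).curryLeft x = τ x • f := by
  ext v
  simp [wedge_apply, Subsingleton.elim v ![], AlternatingMap.curryLeft_apply_apply]

theorem contract_wedge (τ : L →ₗ[ℂ] ℂ) {k : ℕ} (f : L [⋀^Fin (k + 1)]→ₗ[ℂ] M) (x : L) :
    (wedge τ f).curryLeft x = τ x • f - wedge τ (f.curryLeft x) := by
  ext v
  have hr : ∀ (j : Fin (k + 1)), j.succ.removeNth
      (Fin.cons x v : Fin (k + 2) → L) = Fin.cons x (j.removeNth v) := fun j => by
    ext i; cases i using Fin.cases <;> simp [Fin.removeNth]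
  simp only [AlternatingMap.curryLeft_apply_apply, AlternatingMap.sub_apply, wedge_apply,
    Fin.sum_univ_succ (n := k + 1), Matrix.vecCons, AlternatingMap.smul_apply, hr]
  simp [pow_succ, sub_eq_add_neg]

theorem cochainAction_wedge (D : Module.End ℂ L) (E : Module.End ℂ M) (τ : L →ₗ[ℂ] ℂ) {k : ℕ}
    (f : L [⋀^Fin k]→ₗ[ℂ] M) :
    cochainAction D E (k + 1) (wedge τ f) = wedge τ (cochainAction D E k f) - wedge (τ ∘ₗ D) f := by
  induction k with
  | zero =>
    refine cochain_ext fun y => ?_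
    simp only [contract_cochainAction, contract_sub, contract_wedge_zero, map_smul,
      LinearMap.comp_apply]
  | succ k ih =>
    refine cochain_ext fun y => ?_
    simp only [contract_cochainAction, contract_sub, contract_wedge, map_smul, map_sub, ih,
      LinearMap.comp_apply, wedge_sub]
    abel

theorem wedge_zero_left {k : ℕ} (f : L [⋀^Fin k]→ₗ[ℂ] M) : wedge 0 f = 0 := by
  ext v; simp [wedge_apply]

theorem wedge_zero_right (τ : L →ₗ[ℂ] ℂ) {k : ℕ} : wedge τ (0 : L [⋀^Fin k]→ₗ[ℂ] M) = 0 := by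
  ext v; simp [wedge_apply]

/-- A linear form vanishing on brackets is a closed `1`-cochain with trivial coefficients, so the
exterior product with it anticommutes with the differential. -/
theorem differential_wedge (ρ : L →ₗ⁅ℂ⁆ Module.End ℂ M) (τ : L →ₗ[ℂ] ℂ)
    (hτ : ∀ x y : L, τ ⁅x, y⁆ = 0) {k : ℕ} (f : L [⋀^Fin k]→ₗ[ℂ] M) :
    differential ρ (k + 1) (wedge τ f) = -wedge τ (differential ρ k f) := by
  have hτ' : ∀ x, τ ∘ₗ LieModule.toEnd ℂ L L x = 0 := fun x => LinearMap.ext fun y => hτ x y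
  induction k with
  | zero =>
    refine cochain_ext fun y => ?_
    rw [contract_differential, cochainAction_wedge, hτ', wedge_zero_left, contract_wedge_zero,
      contract_neg, contract_wedge, contract_differential_zero, map_smul]
    abel
  | succ k ih =>
    refine cochain_ext fun y => ?_
    rw [contract_differential, cochainAction_wedge, hτ', wedge_zero_left, contract_wedge,
      contract_neg, contract_wedge, contract_differential, map_sub, map_smul, ih, wedge_sub]
    abel

end Cartan

section Pullback

variable {L L' M : Type*} [LieRing L] [LieAlgebra ℂ L] [LieRing L'] [LieAlgebra ℂ L']
  [AddCommGroup M] [Module ℂ M]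

theorem cochainAction_compLinearMap (p : L' →ₗ[ℂ] L) (D' : Module.End ℂ L') (D : Module.End ℂ L)
    (hp : ∀ x, p (D' x) = D (p x)) (E : Module.End ℂ M) {k : ℕ} (f : L [⋀^Fin k]→ₗ[ℂ] M) :
    cochainAction D' E k (f.compLinearMap p) = (cochainAction D E k f).compLinearMap p := by
  ext v
  simp only [cochainAction_apply, AlternatingMap.compLinearMap_apply]
  congr 1
  refine Finset.sum_congr rfl fun s _ => congrArg f ?_
  rw [← Function.comp_def, Function.comp_update, hp]
  rfl

theorem differential_compLinearMap (φ : L' →ₗ⁅ℂ⁆ L) (ρ : L →ₗ⁅ℂ⁆ Module.End ℂ M) {k : ℕ}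
    (f : L [⋀^Fin k]→ₗ[ℂ] M) :
    differential (ρ.comp φ) k (f.compLinearMap (φ : L' →ₗ[ℂ] L)) =
      (differential ρ k f).compLinearMap (φ : L' →ₗ[ℂ] L) := by
  ext v
  cases k with
  | zero =>
    simp [differential_zero_apply, Matrix.empty_eq]
  | succ k =>
    simp only [differential_succ_apply, AlternatingMap.compLinearMap_apply]
    congr 1
    refine Finset.sum_congr rfl fun j _ => Finset.sum_congr rfl fun i _ => ?_
    congr 3
    ext l
    cases l using Fin.cases <;> simp [Fin.removeNth]

end Pullback

/-! ### Commuting semisimple operators -/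

section Semisimple

variable {V W : Type*} [AddCommGroup V] [Module ℂ V] [AddCommGroup W] [Module ℂ W]

theorem aeval_intertwine (ι : V →ₗ[ℂ] W) (A : Module.End ℂ V) (B : Module.End ℂ W)
    (h : ∀ v, ι (A v) = B (ι v)) (p : Polynomial ℂ) (v : V) :
    ι (Polynomial.aeval A p v) = Polynomial.aeval B p (ι v) := by
  induction p using Polynomial.induction_on' with
  | add p q hp hq => simp [hp, hq]
  | monomial n a =>
    have : ∀ n, ι ((A ^ n) v) = (B ^ n) (ι v) := fun n => by
      induction n with
      | zero => simp
      | succ n ih => simp [pow_succ', h, ih]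
    simp [Polynomial.aeval_monomial, Module.algebraMap_end_apply, this]

theorem isSemisimple_of_injective [FiniteDimensional ℂ W] (ι : V →ₗ[ℂ] W)
    (hι : Function.Injective ι) (A : Module.End ℂ V) (B : Module.End ℂ W)
    (h : ∀ v, ι (A v) = B (ι v)) (hB : B.IsSemisimple) : A.IsSemisimple := by
  refine Module.End.isSemisimple_of_squarefree_aeval_eq_zero hB.minpoly_squarefree ?_
  ext v
  apply hι
  rw [aeval_intertwine ι A B h, minpoly.aeval]
  simp

theorem isSemisimple_compRight [FiniteDimensional ℂ W] (A : Module.End ℂ W)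
    (hA : A.IsSemisimple) :
    Module.End.IsSemisimple (M := V →ₗ[ℂ] W) (LinearMap.llcomp ℂ V W W A) := by
  refine Module.End.isSemisimple_of_squarefree_aeval_eq_zero hA.minpoly_squarefree ?_
  ext φ v
  have := aeval_intertwine (LinearMap.applyₗ (R := ℂ) (M₂ := W) v) (LinearMap.llcomp ℂ V W W A) A
    (fun φ => rfl) (minpoly ℂ A) φ
  simpa using this

theorem isSemisimple_lcomp [FiniteDimensional ℂ V] (D : Module.End ℂ V)
    (hD : D.IsSemisimple) : Module.End.IsSemisimple (LinearMap.lcomp ℂ W D) := by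
  refine Module.End.isSemisimple_of_squarefree_aeval_eq_zero hD.minpoly_squarefree ?_
  have key : ∀ (p : Polynomial ℂ) (φ : V →ₗ[ℂ] W),
      Polynomial.aeval (LinearMap.lcomp ℂ W D) p φ = φ ∘ₗ Polynomial.aeval D p := fun p φ => by
    induction p using Polynomial.induction_on' with
    | add p q hp hq => simp [hp, hq, LinearMap.comp_add]
    | monomial n a =>
      have : ∀ n, ((LinearMap.lcomp ℂ W D) ^ n) φ = φ ∘ₗ (D ^ n) := fun n => by
        induction n with
        | zero => rfl
        | succ n ih => rw [pow_succ', Module.End.mul_apply, ih, pow_succ]; rfl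
      ext v
      simp [Polynomial.aeval_monomial, Module.algebraMap_end_apply, this]
  ext φ
  rw [key, minpoly.aeval]
  simp

theorem isSemisimple_of_iSup_eigenspace [FiniteDimensional ℂ V] (A : Module.End ℂ V)
    (hA : ⨆ μ : ℂ, A.eigenspace μ = ⊤) : A.IsSemisimple := by
  classical
  have hfin := Module.End.finite_hasEigenvalue A
  set p : Polynomial ℂ := ∏ μ ∈ hfin.toFinset, (Polynomial.X - Polynomial.C (id μ)) with hp
  refine Module.End.isSemisimple_of_squarefree_aeval_eq_zero (p := p)
    (Polynomial.separable_prod_X_sub_C_iff'.2 fun _ _ _ _ h => h).squarefree ?_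
  rw [← LinearMap.ker_eq_top, eq_top_iff, ← hA]
  refine iSup_le fun μ v hv => ?_
  by_cases hv0 : v = 0
  · simp [hv0]
  have hev : A.HasEigenvector μ v := ⟨hv, hv0⟩
  have hμ : μ ∈ hfin.toFinset :=
    hfin.mem_toFinset.2 (Module.End.hasEigenvalue_of_hasEigenvector hev)
  rw [LinearMap.mem_ker, Module.End.aeval_apply_of_hasEigenvector hev, hp, Polynomial.eval_prod,
    Finset.prod_eq_zero hμ (by simp), zero_smul]

theorem ker_sq [FiniteDimensional ℂ V] (A : Module.End ℂ V) (hA : A.IsSemisimple) (v : V)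
    (hv : A (A v) = 0) : A v = 0 := by
  have h := hA.isFinitelySemisimple.genEigenspace_eq_eigenspace 0 (k := (2 : ℕ)) (by simp)
  have hv' : v ∈ A.genEigenspace 0 (2 : ℕ) := by
    rw [Module.End.mem_genEigenspace_nat]
    simpa [pow_two] using hv
  rw [h] at hv'
  simpa using Module.End.mem_eigenspace_iff.1 hv'

/-- If a semisimple `A` maps `v` into an `A`-stable subspace `B`, then `v` is congruent modulo `B`
to an element of the kernel of `A`. -/
theorem exists_mem_sub_ker [FiniteDimensional ℂ V] (A : Module.End ℂ V) (hA : A.IsSemisimple)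
    (B : Submodule ℂ V) (hB : ∀ b ∈ B, A b ∈ B) (v : V) (hv : A v ∈ B) :
    ∃ b ∈ B, A (v - b) = 0 := by
  have hdisj : Disjoint (LinearMap.range (A.restrict hB)) (LinearMap.ker (A.restrict hB)) := by
    rw [Submodule.disjoint_def]
    rintro _ ⟨b, rfl⟩ hb
    have hb' := congrArg Subtype.val (LinearMap.mem_ker.1 hb)
    exact Subtype.ext (ker_sq A hA b (by simpa using hb'))
  have htop := Submodule.eq_top_of_disjoint _ _
    (LinearMap.finrank_range_add_finrank_ker (A.restrict hB)).ge hdisj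
  obtain ⟨_, ⟨b, rfl⟩, z, hz, hbz⟩ := Submodule.mem_sup.1
    (htop.ge (Submodule.mem_top : (⟨A v, hv⟩ : B) ∈ ⊤))
  have hbz' : A b + z = A v := congrArg Subtype.val hbz
  have hz' : A z = 0 := congrArg Subtype.val (LinearMap.mem_ker.1 hz)
  refine ⟨b, b.2, ker_sq A hA _ ?_⟩
  rw [map_sub, ← hbz', add_sub_cancel_left, hz']

/-- The version of `exists_mem_sub_ker` for finitely many commuting operators: the correction for a
further operator is chosen in the common kernel of the previous ones. -/
theorem exists_mem_forall_sub_ker [FiniteDimensional ℂ V] {ι : Type*} (A : ι → Module.End ℂ V)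
    (hA : ∀ i, (A i).IsSemisimple) (hc : ∀ i j v, A i (A j v) = A j (A i v))
    (B : Submodule ℂ V) (hB : ∀ i, ∀ b ∈ B, A i b ∈ B) (v : V) (hv : ∀ i, A i v ∈ B)
    (S : Finset ι) :
    ∃ b ∈ B, ∀ i ∈ S, A i (v - b) = 0 := by
  classical
  induction S using Finset.induction_on with
  | empty => exact ⟨0, B.zero_mem, by simp⟩
  | insert j S _ ih =>
    obtain ⟨b, hb, h⟩ := ih
    obtain ⟨c, hc', h'⟩ := exists_mem_sub_ker (A j) (hA j)
      (B ⊓ ⨅ i ∈ S, LinearMap.ker (A i)) (by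
        simp only [Submodule.mem_inf, Submodule.mem_iInf, LinearMap.mem_ker]
        rintro x ⟨hx, hx'⟩
        exact ⟨hB j x hx, fun i hi => by rw [hc, hx' i hi, map_zero]⟩) (v - b) (by
        simp only [Submodule.mem_inf, Submodule.mem_iInf, LinearMap.mem_ker]
        exact ⟨by rw [map_sub]; exact B.sub_mem (hv j) (hB j b hb),
          fun i hi => by rw [hc, h i hi, map_zero]⟩)
    simp only [Submodule.mem_inf, Submodule.mem_iInf, LinearMap.mem_ker] at hc'
    refine ⟨b + c, B.add_mem hb hc'.1, fun i hi => ?_⟩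
    rw [← sub_sub]
    rcases Finset.mem_insert.1 hi with rfl | hi
    · exact h'
    · rw [map_sub, h i hi, hc'.2 i hi, sub_zero]

end Semisimple

/-! ### Semisimplicity of the action on cochains -/

section CochainSemisimple

variable {L M : Type*} [LieRing L] [LieAlgebra ℂ L] [AddCommGroup M] [Module ℂ M]
  [FiniteDimensional ℂ L] [FiniteDimensional ℂ M]

instance finiteDimensional_cochain (k : ℕ) : FiniteDimensional ℂ (L [⋀^Fin k]→ₗ[ℂ] M) :=
  Module.Finite.of_injective (AlternatingMap.toMultilinearMapLM (S := ℂ))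
    AlternatingMap.coe_multilinearMap_injective

theorem isSemisimple_cochainAction (D : Module.End ℂ L) (E : Module.End ℂ M)
    (hD : D.IsSemisimple) (hE : E.IsSemisimple) (k : ℕ) :
    Module.End.IsSemisimple (cochainAction D E k) := by
  induction k with
  | zero =>
    refine isSemisimple_of_injective
      { toFun := fun f : L [⋀^Fin 0]→ₗ[ℂ] M => f ![], map_add' := fun _ _ => rfl,
        map_smul' := fun _ _ => rfl } (fun f g h => ?_) _ E (fun f => ?_) hE
    · ext v; rw [Subsingleton.elim v ![]]; exact h
    · simp [cochainAction_apply]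
  | succ k ih =>
    refine isSemisimple_of_injective AlternatingMap.curryLeftLinearMap
      (fun f g h => cochain_ext fun x => congrArg (fun u => u x) h) _
      (LinearMap.llcomp ℂ L _ _ (cochainAction D E k) - LinearMap.lcomp ℂ _ D) (fun f => ?_) ?_
    · ext x : 1
      exact contract_cochainAction D E f x
    · exact (isSemisimple_compRight _ ih).sub_of_commute (LinearMap.ext fun φ => rfl)
        (isSemisimple_lcomp D hD)

end CochainSemisimple

/-! ### Invariant representatives of cohomology classes -/

theorem exists_mem_forall_sub_ker_of_linear {V : Type*} [AddCommGroup V] [Module ℂ V]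
    [FiniteDimensional ℂ V] {S : Type*} [AddCommGroup S] [Module ℂ S] [FiniteDimensional ℂ S]
    (A : S →ₗ[ℂ] Module.End ℂ V) (hA : ∀ t, (A t).IsSemisimple)
    (hc : ∀ t t' v, A t (A t' v) = A t' (A t v)) (B : Submodule ℂ V)
    (hB : ∀ t, ∀ b ∈ B, A t b ∈ B) (v : V) (hv : ∀ t, A t v ∈ B) :
    ∃ b ∈ B, ∀ t, A t (v - b) = 0 := by
  obtain ⟨b, hb, h⟩ := exists_mem_forall_sub_ker (fun i => A (Module.finBasis ℂ S i))
    (fun i => hA _) (fun i j => hc _ _) B (fun i => hB _) v (fun i => hv _) Finset.univ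
  refine ⟨b, hb, fun t => ?_⟩
  have : LinearMap.applyₗ (R := ℂ) (M₂ := V) (v - b) ∘ₗ A = 0 :=
    (Module.finBasis ℂ S).ext fun i => h i (Finset.mem_univ i)
  exact congrArg (fun u => u t) this

section Reductions

variable {L M : Type*} [LieRing L] [LieAlgebra ℂ L] [AddCommGroup M] [Module ℂ M]

theorem subsingleton_cohomology_iff (ρ : L →ₗ⁅ℂ⁆ Module.End ℂ M) (k : ℕ) :
    Subsingleton (Cohomology ρ k) ↔ cocycles ρ k ≤ coboundaries ρ k := by
  rw [Submodule.Quotient.subsingleton_iff, Submodule.submoduleOf_eq_top]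

theorem coboundaries_le_cocycles (ρ : L →ₗ⁅ℂ⁆ Module.End ℂ M) (k : ℕ) :
    coboundaries ρ k ≤ cocycles ρ k := by
  cases k with
  | zero => exact bot_le
  | succ k =>
    rintro _ ⟨g, rfl⟩
    exact differential_differential ρ g

theorem cochainAction_mem_coboundaries (ρ : L →ₗ⁅ℂ⁆ Module.End ℂ M) (D : Module.End ℂ L)
    (E : Module.End ℂ M) (hD : ∀ x y, D ⁅x, y⁆ = ⁅D x, y⁆ + ⁅x, D y⁆)
    (hE : ∀ x m, E (ρ x m) = ρ (D x) m + ρ x (E m)) {k : ℕ} {f : L [⋀^Fin k]→ₗ[ℂ] M}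
    (hf : f ∈ coboundaries ρ k) : cochainAction D E k f ∈ coboundaries ρ k := by
  cases k with
  | zero => rw [(Submodule.mem_bot ℂ).1 hf, map_zero]; exact Submodule.zero_mem _
  | succ k =>
    obtain ⟨g, rfl⟩ := hf
    exact ⟨_, (cochainAction_differential ρ D E hD hE g).symm⟩

theorem cochainAction_mem_cocycles (ρ : L →ₗ⁅ℂ⁆ Module.End ℂ M) (D : Module.End ℂ L)
    (E : Module.End ℂ M) (hD : ∀ x y, D ⁅x, y⁆ = ⁅D x, y⁆ + ⁅x, D y⁆)
    (hE : ∀ x m, E (ρ x m) = ρ (D x) m + ρ x (E m)) {k : ℕ} {f : L [⋀^Fin k]→ₗ[ℂ] M}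
    (hf : f ∈ cocycles ρ k) : cochainAction D E k f ∈ cocycles ρ k := by
  have hf' : differential ρ k f = 0 := hf
  change differential ρ k _ = 0
  rw [← cochainAction_differential ρ D E hD hE, hf', map_zero]

end Reductions

section Family

variable {L M S : Type*} [LieRing L] [LieAlgebra ℂ L] [AddCommGroup M] [Module ℂ M]
  [AddCommGroup S] [Module ℂ S]

/-- The action on cochains induced by linear families of endomorphisms of `L` and of `M`. -/
def cochainFamily (D : S →ₗ[ℂ] Module.End ℂ L) (E : S →ₗ[ℂ] Module.End ℂ M) (k : ℕ) :
    S →ₗ[ℂ] Module.End ℂ (L [⋀^Fin k]→ₗ[ℂ] M) where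
  toFun t := cochainAction (D t) (E t) k
  map_add' t t' := by rw [map_add, map_add, cochainAction_add]
  map_smul' c t := by rw [map_smul, map_smul, cochainAction_smul]; rfl

/-- The linear space `S` acts on `L` by derivations and compatibly on the representation `ρ`,
through commuting semisimple endomorphisms. -/
structure IsTorusAction (ρ : L →ₗ⁅ℂ⁆ Module.End ℂ M) (D : S →ₗ[ℂ] Module.End ℂ L)
    (E : S →ₗ[ℂ] Module.End ℂ M) : Prop where
  leibniz : ∀ t x y, D t ⁅x, y⁆ = ⁅D t x, y⁆ + ⁅x, D t y⁆
  compat : ∀ t x m, E t (ρ x m) = ρ (D t x) m + ρ x (E t m)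
  commute_left : ∀ t t', D t * D t' = D t' * D t
  commute_right : ∀ t t', E t * E t' = E t' * E t
  semisimple_left : ∀ t, (D t).IsSemisimple
  semisimple_right : ∀ t, (E t).IsSemisimple

variable [FiniteDimensional ℂ L] [FiniteDimensional ℂ M] [FiniteDimensional ℂ S]
  {ρ : L →ₗ⁅ℂ⁆ Module.End ℂ M} {D : S →ₗ[ℂ] Module.End ℂ L} {E : S →ₗ[ℂ] Module.End ℂ M}

theorem IsTorusAction.exists_invariant_sub (h : IsTorusAction ρ D E) {k : ℕ}
    (B : Submodule ℂ (L [⋀^Fin k]→ₗ[ℂ] M))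
    (hB : ∀ t, ∀ b ∈ B, cochainAction (D t) (E t) k b ∈ B) (f : L [⋀^Fin k]→ₗ[ℂ] M)
    (hf : ∀ t, cochainAction (D t) (E t) k f ∈ B) :
    ∃ b ∈ B, ∀ t, cochainAction (D t) (E t) k (f - b) = 0 := by
  refine exists_mem_forall_sub_ker_of_linear (cochainFamily D E k)
    (fun t => isSemisimple_cochainAction _ _ (h.semisimple_left t) (h.semisimple_right t) k)
    (fun t t' g => ?_) B hB f hf
  have := cochainAction_lie (D t) (D t') (E t) (E t') g
  rw [h.commute_left, h.commute_right, sub_self, sub_self] at this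
  refine sub_eq_zero.1 (this.trans ?_)
  ext v
  simp [cochainAction_apply]

theorem IsTorusAction.exists_invariant_sub_coboundary (h : IsTorusAction ρ D E) {k : ℕ}
    (f : L [⋀^Fin k]→ₗ[ℂ] M) (hf : ∀ t, cochainAction (D t) (E t) k f ∈ coboundaries ρ k) :
    ∃ b ∈ coboundaries ρ k, ∀ t, cochainAction (D t) (E t) k (f - b) = 0 :=
  h.exists_invariant_sub _ (fun t _ hb =>
    cochainAction_mem_coboundaries ρ _ _ (h.leibniz t) (h.compat t) hb) f hf

/-- An invariant coboundary is the differential of an invariant cochain. -/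
theorem IsTorusAction.exists_invariant_primitive (h : IsTorusAction ρ D E) {k : ℕ}
    (g : L [⋀^Fin k]→ₗ[ℂ] M)
    (hg : ∀ t, cochainAction (D t) (E t) (k + 1) (differential ρ k g) = 0) :
    ∃ g', differential ρ k g' = differential ρ k g ∧ ∀ t, cochainAction (D t) (E t) k g' = 0 := by
  obtain ⟨b, hb, hb'⟩ := h.exists_invariant_sub (cocycles ρ k) (fun t _ hb =>
    cochainAction_mem_cocycles ρ _ _ (h.leibniz t) (h.compat t) hb) g (fun t => by
      change differential ρ k _ = 0
      rw [← cochainAction_differential ρ _ _ (h.leibniz t) (h.compat t), hg])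
  have hb0 : differential ρ k b = 0 := hb
  exact ⟨g - b, by rw [map_sub, hb0, sub_zero], hb'⟩

end Family

/-! ### Comparison of the cohomologies of `N` and `N ⋊ T` -/

section PullbackExtension

variable {N : Type*} [LieRing N] [LieAlgebra ℂ N] {T : LieSubalgebra ℂ (LieDerivation ℂ N N)}
  {M : Type*} [AddCommGroup M] [Module ℂ M]

open LieAlgebra.SemiDirectSum

/-- A cochain on `N ⋊ T` that vanishes as soon as one argument lies in `T` is the pullback of its
restriction to `N`. -/
theorem eq_pullback_of_vanish {k : ℕ} (G : Extension T [⋀^Fin k]→ₗ[ℂ] M)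
    (h : ∀ v i t, v i = inr T.incl t → G v = 0) :
    G = (G.compLinearMap (inl T.incl : N →ₗ[ℂ] Extension T)).compLinearMap
      (projl T.incl) := by
  induction k with
  | zero => ext v; exact congrArg G (Subsingleton.elim _ _)
  | succ k ih =>
    refine cochain_ext fun x => ?_
    have hx : x = inl T.incl x.left +
      inr T.incl x.right := by simp
    have h0 : G.curryLeft (inr T.incl x.right) = 0 := by
      ext v
      exact h _ 0 x.right rfl
    have h1 : G.curryLeft x = G.curryLeft (inl T.incl x.left) := by
      conv_lhs => rw [hx, map_add, h0, add_zero]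
    rw [h1, ih (G.curryLeft (inl T.incl x.left)) fun v i t hv =>
      h _ i.succ t (by simpa [Matrix.vecCons] using hv)]
    ext v
    refine congrArg G (funext fun i => ?_)
    cases i using Fin.cases <;> rfl

theorem eq_pullback {k : ℕ} (G : Extension T [⋀^Fin (k + 1)]→ₗ[ℂ] M)
    (h : ∀ t, G.curryLeft (inr T.incl t) = 0) :
    G = (G.compLinearMap (inl T.incl : N →ₗ[ℂ] Extension T)).compLinearMap
      (projl T.incl) := by
  refine eq_pullback_of_vanish G fun v i t hv => ?_
  have h1 := G.map_insertNth i (v i) (i.removeNth v)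
  rw [Fin.insertNth_removeNth, Function.update_eq_self] at h1
  rw [h1, hv]
  have h2 : G (Matrix.vecCons (inr T.incl t) (i.removeNth v)) = 0 :=
    congrArg (fun u => u (i.removeNth v)) (h t)
  rw [h2, smul_zero]

theorem restrict_pullback (T : LieSubalgebra ℂ (LieDerivation ℂ N N)) {k : ℕ}
    (f : N [⋀^Fin k]→ₗ[ℂ] M) :
    (f.compLinearMap (projl T.incl)).compLinearMap
      (inl T.incl : N →ₗ[ℂ] Extension T) = f := rfl

end PullbackExtension

section HochschildSerre

open LieAlgebra.SemiDirectSum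

variable {N : Type*} [LieRing N] [LieAlgebra ℂ N] {T : LieSubalgebra ℂ (LieDerivation ℂ N N)}
  {M : Type*} [AddCommGroup M] [Module ℂ M] [LieRingModule (Extension T) M]
  [LieModule ℂ (Extension T) M]

theorem torusOnN_apply (t : T) (x : N) : torusOnN T t x = (t : LieDerivation ℂ N N) x := rfl

theorem lie_inr_inl (t : T) (x : N) :
    ⁅inr T.incl t, inl T.incl x⁆ = inl T.incl (torusOnN T t x) := by
  simp [torusOnN_apply]

theorem IsTorus.commute (hT : IsTorus T) (t t' : T) : ⁅t, t'⁆ = 0 :=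
  Subtype.ext (hT.1 t t.2 t' t'.2)

instance finiteDimensional_extension [FiniteDimensional ℂ N] :
    FiniteDimensional ℂ (Extension T) :=
  Module.Finite.equiv (toProdl T.incl).symm

theorem IsTorus.isSemisimple_torusOnN [FiniteDimensional ℂ N] (hT : IsTorus T) (t : T) :
    (torusOnN T t).IsSemisimple :=
  isSemisimple_of_iSup_eigenspace _ (hT.2 t t.2)

theorem IsTorus.torusOnN_mul_comm (hT : IsTorus T) (t t' : T) :
    torusOnN T t * torusOnN T t' = torusOnN T t' * torusOnN T t := by
  ext x
  have := congrArg (fun D : LieDerivation ℂ N N => D x) (hT.1 t t.2 t' t'.2)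
  simpa [sub_eq_zero, torusOnN_apply] using this

theorem IsTorus.isTorusAction_nil [FiniteDimensional ℂ N] (hT : IsTorus T)
    (hM : ∀ t, (torusOnModule T M t).IsSemisimple) :
    IsTorusAction (nilOnModule T M) (torusOnN T) (torusOnModule T M) where
  leibniz t x y := ((t : LieDerivation ℂ N N).apply_lie_eq_add x y).trans (add_comm _ _)
  compat t x m := by
    have := lie_lie (inr T.incl t) (inl T.incl x) m
    rw [lie_inr_inl] at this
    exact (eq_add_of_sub_eq this.symm)
  commute_left := hT.torusOnN_mul_comm
  commute_right t t' := by
    ext m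
    have := lie_lie (inr T.incl t) (inr T.incl t') m
    rw [← LieHom.map_lie, hT.commute, map_zero, zero_lie, eq_comm, sub_eq_zero] at this
    exact this
  semisimple_left := hT.isSemisimple_torusOnN
  semisimple_right := hM

theorem IsTorus.isSemisimple_adjoint [FiniteDimensional ℂ N] (hT : IsTorus T) (t : T) :
    (torusOnModule T (Extension T) t).IsSemisimple := by
  refine isSemisimple_of_iSup_eigenspace _ (eq_top_iff.2 fun x _ => ?_)
  have hx : x = inl T.incl x.left +
      inr T.incl x.right := by simp
  rw [hx]
  refine Submodule.add_mem _ ?_ ?_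
  · have hle : Submodule.map (inl T.incl : N →ₗ[ℂ] Extension T)
        (⨆ μ : ℂ, (torusOnN T t).eigenspace μ) ≤
        ⨆ μ : ℂ, (torusOnModule T (Extension T) t).eigenspace μ := by
      rw [Submodule.map_iSup]
      refine iSup_mono fun μ => ?_
      rintro _ ⟨n, hn, rfl⟩
      rw [Module.End.mem_eigenspace_iff]
      refine (lie_inr_inl t n).trans ?_
      rw [Module.End.mem_eigenspace_iff.1 hn, map_smul]
      rfl
    exact hle ⟨x.left, (hT.2 t t.2).ge Submodule.mem_top, rfl⟩
  · refine Submodule.mem_iSup_of_mem 0 ?_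
    rw [Module.End.mem_eigenspace_iff, zero_smul]
    refine (LieHom.map_lie (inr T.incl) t x.right).symm.trans ?_
    rw [hT.commute, map_zero]

theorem IsTorus.isTorusAction_extension [FiniteDimensional ℂ N] (hT : IsTorus T)
    (hM : ∀ t, (torusOnModule T M t).IsSemisimple) :
    IsTorusAction (LieModule.toEnd ℂ (Extension T) M) (torusOnModule T (Extension T))
      (torusOnModule T M) where
  leibniz t x y := leibniz_lie (inr T.incl t) x y
  compat t x m := leibniz_lie (inr T.incl t) x m
  commute_left t t' := by
    ext1 m
    have := lie_lie (inr T.incl t) (inr T.incl t') m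
    rw [← LieHom.map_lie, hT.commute, map_zero, zero_lie, eq_comm, sub_eq_zero] at this
    exact this
  commute_right t t' := by
    ext m
    have := lie_lie (inr T.incl t) (inr T.incl t') m
    rw [← LieHom.map_lie, hT.commute, map_zero, zero_lie, eq_comm, sub_eq_zero] at this
    exact this
  semisimple_left := hT.isSemisimple_adjoint
  semisimple_right := hM

theorem invariantCohomology_eq_bot_iff [FiniteDimensional ℂ N] [FiniteDimensional ℂ M]
    (hT : IsTorus T) (hM : ∀ t, (torusOnModule T M t).IsSemisimple) (k : ℕ) :
    invariantCohomology T M k = ⊥ ↔ ∀ f ∈ cocycles (nilOnModule T M) k,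
      (∀ t, cochainAction (torusOnN T t) (torusOnModule T M t) k f = 0) →
        f ∈ coboundaries (nilOnModule T M) k := by
  constructor
  · intro h f hf hinv
    have hmem : Submodule.Quotient.mk ⟨f, hf⟩ ∈ invariantCohomology T M k := by
      refine ⟨⟨f, hf⟩, ?_, rfl⟩
      rw [SetLike.mem_coe, Submodule.mem_comap, Submodule.mem_iInf]
      intro t
      rw [Submodule.mem_comap, Submodule.subtype_apply, hinv]
      exact Submodule.zero_mem _
    rw [h, Submodule.mem_bot, Submodule.Quotient.mk_eq_zero] at hmem
    exact hmem
  · intro h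
    rw [eq_bot_iff]
    rintro _ ⟨f, hf, rfl⟩
    rw [SetLike.mem_coe, Submodule.mem_comap, Submodule.mem_iInf] at hf
    obtain ⟨b, hb, hinv⟩ := (hT.isTorusAction_nil hM).exists_invariant_sub_coboundary
      (f : N [⋀^Fin k]→ₗ[ℂ] M) hf
    rw [Submodule.mem_bot, Submodule.mkQ_apply, Submodule.Quotient.mk_eq_zero]
    change (f : N [⋀^Fin k]→ₗ[ℂ] M) ∈ coboundaries (nilOnModule T M) k
    have := Submodule.add_mem _ (h _ (Submodule.sub_mem _ f.2 (coboundaries_le_cocycles _ k hb))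
      hinv) hb
    rwa [sub_add_cancel] at this

/-- The projection `N ⋊ T → N` is not a Lie algebra homomorphism, but pullback along it commutes
with the differential on invariant cochains. -/
theorem differential_pullback {k : ℕ} (f : N [⋀^Fin k]→ₗ[ℂ] M)
    (hf : ∀ t, cochainAction (torusOnN T t) (torusOnModule T M t) k f = 0) :
    differential (LieModule.toEnd ℂ (Extension T) M) k
        (f.compLinearMap (projl T.incl)) =
      (differential (nilOnModule T M) k f).compLinearMap
        (projl T.incl) := by
  have hL : ∀ t, cochainAction (LieModule.toEnd ℂ (Extension T) (Extension T)
      (inr T.incl t)) (LieModule.toEnd ℂ (Extension T) M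
      (inr T.incl t)) k
      (f.compLinearMap (projl T.incl)) = 0 := fun t => by
    rw [cochainAction_compLinearMap (projl T.incl) _ (torusOnN T t)
      (fun x => by simp [torusOnN_apply])]
    have := hf t
    rw [torusOnModule] at this
    exact congrArg (fun u : N [⋀^Fin k]→ₗ[ℂ] M =>
      u.compLinearMap (projl T.incl)) this
  rw [eq_pullback (differential (LieModule.toEnd ℂ (Extension T) M) k
        (f.compLinearMap (projl T.incl))) fun t => ?_,
    ← differential_compLinearMap, restrict_pullback T]
  · rfl
  · cases k with
    | zero => rw [contract_differential_zero, hL]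
    | succ k =>
      rw [contract_differential, hL]
      have : (f.compLinearMap (projl T.incl)).curryLeft
          (inr T.incl t) = 0 := by
        ext v
        exact f.map_coord_zero 0 rfl
      rw [this, map_zero, sub_zero]

/-- If `H^k(N ⋊ T, M)` vanishes, then every invariant `k`-cocycle of `N` is a coboundary: it
extends to a cocycle of `N ⋊ T` that is zero on `T`. -/
theorem invariant_cocycle_mem_coboundaries {k : ℕ}
    (h : cocycles (LieModule.toEnd ℂ (Extension T) M) k ≤
      coboundaries (LieModule.toEnd ℂ (Extension T) M) k)
    (f : N [⋀^Fin k]→ₗ[ℂ] M) (hf : f ∈ cocycles (nilOnModule T M) k)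
    (hinv : ∀ t, cochainAction (torusOnN T t) (torusOnModule T M t) k f = 0) :
    f ∈ coboundaries (nilOnModule T M) k := by
  have hf' : differential (nilOnModule T M) k f = 0 := hf
  have hF := h (show f.compLinearMap (projl T.incl) ∈ _ by
    rw [cocycles, LinearMap.mem_ker, differential_pullback f hinv, hf']; rfl)
  cases k with
  | zero =>
    have h0 := (Submodule.mem_bot ℂ).1 hF
    rw [← restrict_pullback T f, h0]
    exact Submodule.zero_mem _
  | succ k =>
    obtain ⟨G, hG⟩ := hF
    refine ⟨G.compLinearMap (inl T.incl : N →ₗ[ℂ] Extension T), ?_⟩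
    rw [nilOnModule, differential_compLinearMap, hG]
    rfl

end HochschildSerre

theorem wedge_mem_coboundaries {L M : Type*} [LieRing L] [LieAlgebra ℂ L] [AddCommGroup M]
    [Module ℂ M] (ρ : L →ₗ⁅ℂ⁆ Module.End ℂ M) (τ : L →ₗ[ℂ] ℂ) (hτ : ∀ x y : L, τ ⁅x, y⁆ = 0) {k : ℕ}
    {f : L [⋀^Fin k]→ₗ[ℂ] M} (hf : f ∈ coboundaries ρ k) :
    wedge τ f ∈ coboundaries ρ (k + 1) := by
  cases k with
  | zero =>
    rw [(Submodule.mem_bot ℂ).1 hf, wedge_zero_right]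
    exact Submodule.zero_mem _
  | succ k =>
    obtain ⟨g, rfl⟩ := hf
    exact ⟨-wedge τ g, by rw [map_neg, differential_wedge ρ τ hτ, neg_neg]⟩

section HochschildSerre

open LieAlgebra.SemiDirectSum

variable {N : Type*} [LieRing N] [LieAlgebra ℂ N] {T : LieSubalgebra ℂ (LieDerivation ℂ N N)}
  {M : Type*} [AddCommGroup M] [Module ℂ M] [LieRingModule (Extension T) M]
  [LieModule ℂ (Extension T) M]

/-- An invariant cocycle on `N ⋊ T` is cohomologous to an invariant cocycle killed by the
contractions with prescribed basis elements of `T`. For one element `t` with coordinate form `τ`,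
subtract `τ ∧ i_t F`, which is a coboundary since `i_t F` is one by the hypothesis in lower degree.
-/
theorem exists_basic_cohomologous (hT : IsTorus T) {ι : Type*} (b : Module.Basis ι ℂ T) {n : ℕ}
    (ih : ∀ u ∈ cocycles (LieModule.toEnd ℂ (Extension T) M) n,
      (∀ t, cochainAction (torusOnModule T (Extension T) t) (torusOnModule T M t) n u = 0) →
      u ∈ coboundaries (LieModule.toEnd ℂ (Extension T) M) n)
    (F : Extension T [⋀^Fin (n + 1)]→ₗ[ℂ] M)
    (hF : F ∈ cocycles (LieModule.toEnd ℂ (Extension T) M) (n + 1))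
    (hinv : ∀ t,
      cochainAction (torusOnModule T (Extension T) t) (torusOnModule T M t) (n + 1) F = 0)
    (S : Finset ι) :
    ∃ F' ∈ cocycles (LieModule.toEnd ℂ (Extension T) M) (n + 1),
      F - F' ∈ coboundaries (LieModule.toEnd ℂ (Extension T) M) (n + 1) ∧
      (∀ t, cochainAction (torusOnModule T (Extension T) t) (torusOnModule T M t) (n + 1) F' = 0) ∧
      ∀ i ∈ S, F'.curryLeft (inr T.incl (b i)) = 0 := by
  classical
  induction S using Finset.induction_on with
  | empty => exact ⟨F, hF, by rw [sub_self]; exact Submodule.zero_mem _, hinv, by simp⟩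
  | insert j S hj IH =>
    obtain ⟨F', hF', hcob, hinv', hS⟩ := IH
    set u := F'.curryLeft (inr T.incl (b j)) with hu
    set τ : Extension T →ₗ[ℂ] ℂ := b.coord j ∘ₗ (projr T.incl : Extension T →ₗ[ℂ] T) with hτdef
    have hτ : ∀ x y : Extension T, τ ⁅x, y⁆ = 0 := fun x y => by
      change b.coord j (projr T.incl ⁅x, y⁆) = 0
      rw [LieHom.map_lie, hT.commute, map_zero]
    have hadj : ∀ t t' : T, torusOnModule T (Extension T) t (inr T.incl t') = 0 := fun t t' => by
      refine (LieHom.map_lie (inr T.incl) t t').symm.trans ?_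
      rw [hT.commute, map_zero]
    have hτinv : ∀ t, τ ∘ₗ torusOnModule T (Extension T) t = 0 := fun t =>
      LinearMap.ext fun x => hτ _ x
    have huinv : ∀ t,
        cochainAction (torusOnModule T (Extension T) t) (torusOnModule T M t) n u = 0 := fun t => by
      have h1 := contract_cochainAction (torusOnModule T (Extension T) t) (torusOnModule T M t) F'
        (inr T.incl (b j))
      rw [hinv', hadj, map_zero, sub_zero] at h1
      exact h1.symm
    have hF0 : differential (LieModule.toEnd ℂ (Extension T) M) (n + 1) F' = 0 := hF'
    have hucoc : u ∈ cocycles (LieModule.toEnd ℂ (Extension T) M) n := by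
      have h1 := contract_differential (LieModule.toEnd ℂ (Extension T) M) F' (inr T.incl (b j))
      rw [hF0] at h1
      have h2 := hinv' (b j)
      change cochainAction (LieModule.toEnd ℂ (Extension T) (Extension T) (inr T.incl (b j)))
        (LieModule.toEnd ℂ (Extension T) M (inr T.incl (b j))) (n + 1) F' = 0 at h2
      rw [h2, zero_sub] at h1
      exact neg_eq_zero.1 h1.symm
    have hw := wedge_mem_coboundaries _ τ hτ (ih u hucoc huinv)
    refine ⟨F' - wedge τ u, Submodule.sub_mem _ hF' (coboundaries_le_cocycles _ _ hw), ?_, ?_, ?_⟩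
    · rw [← sub_add]; exact Submodule.add_mem _ hcob hw
    · intro t
      rw [map_sub, hinv', cochainAction_wedge, huinv, hτinv, wedge_zero_left, wedge_zero_right]
      simp
    · intro i hi
      have hτi : τ (inr T.incl (b i)) = if i = j then 1 else 0 := by
        change b.coord j (b i) = _
        rw [Module.Basis.coord_apply, Module.Basis.repr_self, Finsupp.single_apply]
      have hcontr : (wedge τ u).curryLeft (inr T.incl (b i)) = τ (inr T.incl (b i)) • u := by
        cases n with
        | zero => exact contract_wedge_zero τ u _
        | succ n =>
          have h0 : u.curryLeft (inr T.incl (b i)) = 0 := by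
            rcases Finset.mem_insert.1 hi with rfl | hi
            · exact AlternatingMap.curryLeft_same F' _
            · rw [hu, contract_contract, hS i hi]; simp
          rw [contract_wedge, h0, wedge_zero_right, sub_zero]
      rw [contract_sub, hcontr, hτi]
      rcases Finset.mem_insert.1 hi with rfl | hi'
      · rw [if_pos rfl, one_smul, sub_self]
      · rw [if_neg fun h : i = j => hj (h ▸ hi'), zero_smul, sub_zero, hS i hi']

/-- If every invariant cocycle of `N` is a coboundary, then so is every `T`-invariant cocycle of
`N ⋊ T`. -/
theorem invariant_cocycle_mem_coboundaries_extension [FiniteDimensional ℂ N] [FiniteDimensional ℂ M]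
    (hT : IsTorus T) (hM : ∀ t, (torusOnModule T M t).IsSemisimple)
    (hN : ∀ k, ∀ f ∈ cocycles (nilOnModule T M) k,
      (∀ t, cochainAction (torusOnN T t) (torusOnModule T M t) k f = 0) →
        f ∈ coboundaries (nilOnModule T M) k) (n : ℕ) :
    ∀ F ∈ cocycles (LieModule.toEnd ℂ (Extension T) M) n,
      (∀ t, cochainAction (torusOnModule T (Extension T) t) (torusOnModule T M t) n F = 0) →
      F ∈ coboundaries (LieModule.toEnd ℂ (Extension T) M) n := by
  have restrict_inv : ∀ {n : ℕ} (F : Extension T [⋀^Fin n]→ₗ[ℂ] M),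
      (∀ t, cochainAction (torusOnModule T (Extension T) t) (torusOnModule T M t) n F = 0) →
      ∀ t, cochainAction (torusOnN T t) (torusOnModule T M t) n
        (F.compLinearMap (inl T.incl : N →ₗ[ℂ] Extension T)) = 0 := fun F hF t => by
    rw [cochainAction_compLinearMap _ _ (torusOnModule T (Extension T) t)
      (fun x => (lie_inr_inl t x).symm), hF]
    rfl
  have restrict_coc : ∀ {n : ℕ} (F : Extension T [⋀^Fin n]→ₗ[ℂ] M),
      F ∈ cocycles (LieModule.toEnd ℂ (Extension T) M) n →
      F.compLinearMap (inl T.incl : N →ₗ[ℂ] Extension T) ∈ cocycles (nilOnModule T M) n :=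
      fun {n} F hF => by
    have hF0 : differential (LieModule.toEnd ℂ (Extension T) M) n F = 0 := hF
    change differential ((LieModule.toEnd ℂ (Extension T) M).comp (inl T.incl)) n _ = 0
    rw [differential_compLinearMap, hF0]
    rfl
  induction n with
  | zero =>
    intro F hF hinv
    have h0 := (Submodule.mem_bot ℂ).1 (hN 0 _ (restrict_coc F hF) (restrict_inv F hinv))
    rw [eq_pullback_of_vanish F (fun v i => i.elim0), h0]
    exact Submodule.zero_mem _
  | succ n ih =>
    intro F hF hinv
    obtain ⟨F', hF', hcob, hinv', hb⟩ := exists_basic_cohomologous hT (Module.finBasis ℂ T) ih F hF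
      hinv Finset.univ
    have hbasic : ∀ t, F'.curryLeft (inr T.incl t) = 0 := fun t => by
      have : F'.curryLeft ∘ₗ (inr T.incl : T →ₗ[ℂ] Extension T) = 0 :=
        (Module.finBasis ℂ T).ext fun i => hb i (Finset.mem_univ i)
      exact congrArg (fun u => u t) this
    obtain ⟨g, hg⟩ := hN (n + 1) _ (restrict_coc F' hF') (restrict_inv F' hinv')
    obtain ⟨g', hg', hginv⟩ := (hT.isTorusAction_nil hM).exists_invariant_primitive g (fun t => by
      rw [hg]; exact restrict_inv F' hinv' t)
    have hFmem : F' ∈ coboundaries (LieModule.toEnd ℂ (Extension T) M) (n + 1) :=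
      ⟨g'.compLinearMap (projl T.incl), by
        rw [differential_pullback g' hginv, hg', hg, ← eq_pullback F' hbasic]⟩
    have := Submodule.add_mem _ hcob hFmem
    rwa [sub_add_cancel] at this

theorem subsingleton_cohomology_extension [FiniteDimensional ℂ N] [FiniteDimensional ℂ M]
    (hT : IsTorus T) (hM : ∀ t, (torusOnModule T M t).IsSemisimple)
    (hN : ∀ k, invariantCohomology T M k = ⊥) (n : ℕ) :
    Subsingleton (Cohomology (LieModule.toEnd ℂ (Extension T) M) n) := by
  rw [subsingleton_cohomology_iff]
  intro F hF
  have hF0 : differential (LieModule.toEnd ℂ (Extension T) M) n F = 0 := hF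
  -- By Cartan's formula `L_t F = d i_t F`, so that the class of `F` is invariant.
  obtain ⟨b, hb, hinv⟩ := (hT.isTorusAction_extension hM).exists_invariant_sub_coboundary F
    fun t => by
      change cochainAction (LieModule.toEnd ℂ (Extension T) (Extension T) (inr T.incl t))
        (LieModule.toEnd ℂ (Extension T) M (inr T.incl t)) n F ∈ _
      cases n with
      | zero =>
        rw [← contract_differential_zero, hF0]
        exact Submodule.zero_mem _
      | succ n =>
        have h1 := contract_differential (LieModule.toEnd ℂ (Extension T) M) F (inr T.incl t)
        rw [hF0] at h1
        exact ⟨F.curryLeft (inr T.incl t), (sub_eq_zero.1 h1.symm).symm⟩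
  have := Submodule.add_mem _ (invariant_cocycle_mem_coboundaries_extension hT hM
    (fun k => (invariantCohomology_eq_bot_iff hT hM k).1 (hN k)) n _
    (Submodule.sub_mem _ hF (coboundaries_le_cocycles _ n hb)) hinv) hb
  rwa [sub_add_cancel] at this

end HochschildSerre

/-! ### Simultaneous weight spaces -/

section WeightSpaces

variable {S V : Type*} [AddCommGroup S] [Module ℂ S] [AddCommGroup V] [Module ℂ V]
  {θ : S →ₗ[ℂ] Module.End ℂ V}

theorem mem_weightSpace {α : Module.Dual ℂ S} {v : V} :
    v ∈ weightSpace θ α ↔ ∀ t, θ t v = α t • v := by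
  simp [weightSpace, Submodule.mem_iInf]

theorem mem_weights_of_apply {α : Module.Dual ℂ S} {v : V} (hv : v ≠ 0)
    (h : ∀ t, θ t v = α t • v) : α ∈ weights θ := fun h0 => by
  have hmem := mem_weightSpace.2 h
  rw [h0] at hmem
  exact hv hmem

theorem iSupIndep_weightSpace (hc : ∀ t t', θ t * θ t' = θ t' * θ t) :
    iSupIndep (weightSpace θ) := by
  have h := Module.End.independent_iInf_maxGenEigenspace_of_forall_mapsTo (fun t => θ t)
    (fun i j φ => Module.End.mapsTo_maxGenEigenspace_of_comm (hc j i) φ)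
  refine (h.comp (f := fun α : Module.Dual ℂ S => (α : S → ℂ)) DFunLike.coe_injective).mono
    fun α => ?_
  exact iInf_mono fun t => Module.End.genEigenspace_le_maximal _ _ _

theorem iSup_weightSpace [FiniteDimensional ℂ V] (hc : ∀ t t', θ t * θ t' = θ t' * θ t)
    (hs : ∀ t, (θ t).IsSemisimple) : ⨆ α, weightSpace θ α = ⊤ := by
  have h := Module.End.iSup_iInf_maxGenEigenspace_eq_top_of_forall_mapsTo (fun t => θ t)
    (fun i j φ => Module.End.mapsTo_maxGenEigenspace_of_comm (hc j i) φ)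
    (fun t => by
      rw [(hs t).iSup_maxGenEigenspace_eq_top_iff]
      exact (hs t).iSup_eigenspace_eq_top)
  rw [eq_top_iff, ← h]
  refine iSup_le fun χ => ?_
  by_cases hbot : (⨅ t, (θ t).maxGenEigenspace (χ t)) = ⊥
  · rw [hbot]; exact bot_le
  obtain ⟨v, hv, hv0⟩ := Submodule.exists_mem_ne_zero_of_ne_bot hbot
  have hmem : ∀ w ∈ ⨅ t, (θ t).maxGenEigenspace (χ t), ∀ t, θ t w = χ t • w := fun w hw t => by
    have := (Submodule.mem_iInf _).1 hw t
    rw [(hs t).isFinitelySemisimple.maxGenEigenspace_eq_eigenspace] at this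
    exact Module.End.mem_eigenspace_iff.1 this
  have hv' := hmem v hv
  let α : Module.Dual ℂ S :=
    { toFun := χ
      map_add' := fun t t' => smul_left_injective ℂ hv0 <| by
        simp only [add_smul, ← hv', map_add, LinearMap.add_apply]
      map_smul' := fun c t => smul_left_injective ℂ hv0 <| by
        simp only [smul_assoc, ← hv', map_smul, LinearMap.smul_apply, RingHom.id_apply] }
  exact le_iSup_of_le α fun w hw => mem_weightSpace.2 (hmem w hw)

/-- For a nonzero vector `x` of weight `δ` there is a functional that is `1` on `x` and factors
through the projection onto the weight space of `δ`. -/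
theorem exists_functional_of_weight [FiniteDimensional ℂ V]
    (hc : ∀ t t', θ t * θ t' = θ t' * θ t) (hs : ∀ t, (θ t).IsSemisimple) (δ : Module.Dual ℂ S)
    {x : V} (hx : x ≠ 0) (hxδ : x ∈ weightSpace θ δ) :
    ∃ ψ : V →ₗ[ℂ] ℂ, ψ x = 1 ∧ (∀ t v, ψ (θ t v) = δ t * ψ v) ∧
      ∀ β, β ≠ δ → ∀ v ∈ weightSpace θ β, ψ v = 0 := by
  have hnot : x ∉ ⨆ β, ⨆ (_ : β ≠ δ), weightSpace θ β := fun hmem =>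
    hx ((Submodule.disjoint_def.1 (iSupIndep_weightSpace hc δ)) x hxδ hmem)
  obtain ⟨φ, hφx, hφ⟩ := Submodule.exists_le_ker_of_notMem hnot
  have hφ' : ∀ β, β ≠ δ → ∀ v ∈ weightSpace θ β, φ v = 0 := fun β hβ v hv =>
    hφ (Submodule.mem_iSup_of_mem β (Submodule.mem_iSup_of_mem hβ hv))
  refine ⟨(φ x)⁻¹ • φ, by simp [hφx], fun t v => ?_, fun β hβ v hv => by simp [hφ' β hβ v hv]⟩
  have hv : v ∈ ⨆ α, weightSpace θ α := by rw [iSup_weightSpace hc hs]; trivial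
  induction hv using Submodule.iSup_induction' with
  | mem β v hv =>
    rw [mem_weightSpace.1 hv]
    by_cases hβ : β = δ
    · subst hβ; simp
    · simp [hφ' β hβ v hv]
  | zero => simp
  | add v w _ _ hv hw => rw [map_add, map_add, map_add, hv, hw, mul_add]

end WeightSpaces

/-! ### Right-normed brackets of generators -/

section NestedBracket

variable {N : Type*} [LieRing N] {ι : Type*}

/-- The right-normed bracket `⁅e i₁, ⁅e i₂, …, e iₖ⁆⁆` along a list of indices; it is `0` on the
empty list. -/
def nestedBracket (e : ι → N) : List ι → N
  | [] => 0
  | [i] => e i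
  | i :: j :: l => ⁅e i, nestedBracket e (j :: l)⁆

theorem nestedBracket_cons (e : ι → N) (i : ι) {l : List ι} (hl : l ≠ []) :
    nestedBracket e (i :: l) = ⁅e i, nestedBracket e l⁆ := by
  cases l with
  | nil => exact absurd rfl hl
  | cons j l => rfl

/-- The innermost bracket of a nonzero right-normed bracket is nonzero. -/
theorem exists_lie_ne_zero_of_nestedBracket (e : ι → N) {l : List ι} (h2 : 2 ≤ l.length)
    (hl : nestedBracket e l ≠ 0) : ∃ i ∈ l, ∃ j ∈ l, ⁅e i, e j⁆ ≠ 0 := by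
  induction l with
  | nil => simp at h2
  | cons i l ih =>
    cases l with
    | nil => simp at h2
    | cons j l =>
      cases l with
      | nil => exact ⟨i, by simp, j, by simp, hl⟩
      | cons k l =>
        obtain ⟨a, ha, b, hb, hab⟩ := ih (by simp) fun h0 => hl (by
          rw [nestedBracket_cons e i (List.cons_ne_nil _ _), h0, lie_zero])
        exact ⟨a, List.mem_cons_of_mem _ ha, b, List.mem_cons_of_mem _ hb, hab⟩

variable [LieAlgebra ℂ N]

theorem nestedBracket_mem_lowerCentralSeries (e : ι → N) (l : List ι) :
    nestedBracket e l ∈ LieModule.lowerCentralSeries ℂ N N (l.length - 1) := by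
  induction l with
  | nil => exact Submodule.zero_mem _
  | cons i l ih =>
    cases l with
    | nil => trivial
    | cons j l =>
      rw [nestedBracket_cons e i (List.cons_ne_nil j l)]
      simp only [List.length_cons, Nat.add_sub_cancel] at ih ⊢
      rw [LieModule.lowerCentralSeries_succ]
      exact LieSubmodule.lie_mem_lie (LieSubmodule.mem_top _) ih

theorem length_le_of_nestedBracket_ne_zero (e : ι → N) {s : ℕ}
    (hs : LieModule.lowerCentralSeries ℂ N N s = ⊥) {l : List ι} (hl : nestedBracket e l ≠ 0) :
    l.length ≤ s := by
  by_contra! h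
  have h1 := LieModule.antitone_lowerCentralSeries ℂ N N (show s ≤ l.length - 1 by omega)
    (nestedBracket_mem_lowerCentralSeries e l)
  rw [hs] at h1
  exact hl h1

theorem lie_mem_span_nestedBracket (e : ι → N) (x y : N)
    (hx : x ∈ Submodule.span ℂ (nestedBracket e '' {l | l ≠ []}))
    (hy : y ∈ Submodule.span ℂ (nestedBracket e '' {l | l ≠ []})) :
    ⁅x, y⁆ ∈ Submodule.span ℂ (nestedBracket e '' {l | l ≠ []}) := by
  set G := Submodule.span ℂ (nestedBracket e '' {l | l ≠ []}) with hG
  have hgen : ∀ i, ∀ y ∈ G, ⁅e i, y⁆ ∈ G := fun i y hy => by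
    induction hy using Submodule.span_induction with
    | mem y hy =>
      obtain ⟨l, hl, rfl⟩ := hy
      rw [← nestedBracket_cons e i hl]
      exact Submodule.subset_span ⟨_, List.cons_ne_nil _ _, rfl⟩
    | zero => rw [lie_zero]; exact Submodule.zero_mem _
    | add y z _ _ hy hz => rw [lie_add]; exact Submodule.add_mem _ hy hz
    | smul c y _ hy => rw [lie_smul]; exact Submodule.smul_mem _ _ hy
  induction hx using Submodule.span_induction with
  | mem x hx =>
    obtain ⟨l, -, rfl⟩ := hx
    clear hG
    induction l generalizing y with
    | nil => rw [nestedBracket, zero_lie]; exact Submodule.zero_mem _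
    | cons i l ih =>
      by_cases hl : l = []
      · subst hl; exact hgen i y hy
      · rw [nestedBracket_cons e i hl, lie_lie]
        exact Submodule.sub_mem _ (hgen i _ (ih y hy)) (ih _ (hgen i y hy))
  | zero => rw [zero_lie]; exact Submodule.zero_mem _
  | add x z _ _ hx hz => rw [add_lie]; exact Submodule.add_mem _ hx hz
  | smul c x _ hx => rw [smul_lie]; exact Submodule.smul_mem _ _ hx

/-- In a nilpotent Lie algebra, a subalgebra that together with `[N, N]` spans `N` is all of `N`. -/
theorem eq_top_of_sup_lie_eq_top {s : ℕ} (hs : LieModule.lowerCentralSeries ℂ N N s = ⊥)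
    (G : Submodule ℂ N) (hG : ∀ x ∈ G, ∀ y ∈ G, ⁅x, y⁆ ∈ G)
    (hsup : G ⊔ (⁅(⊤ : LieIdeal ℂ N), (⊤ : LieIdeal ℂ N)⁆ : LieIdeal ℂ N).toSubmodule = ⊤) :
    G = ⊤ := by
  have key : ∀ k, G ⊔ (LieModule.lowerCentralSeries ℂ N N k).toSubmodule = ⊤ := fun k => by
    induction k with
    | zero => simp
    | succ k ih =>
      have hlow : ∀ x : N, ∀ z ∈ LieModule.lowerCentralSeries ℂ N N k,
          ⁅x, z⁆ ∈ LieModule.lowerCentralSeries ℂ N N (k + 1) := fun x z hz => by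
        rw [LieModule.lowerCentralSeries_succ]
        exact LieSubmodule.lie_mem_lie (LieSubmodule.mem_top _) hz
      rw [eq_top_iff, ← hsup]
      refine sup_le le_sup_left ?_
      rw [LieSubmodule.lieIdeal_oper_eq_linear_span, Submodule.span_le]
      rintro _ ⟨⟨x, -⟩, ⟨y, -⟩, rfl⟩
      obtain ⟨a, ha, z, hz, rfl⟩ := Submodule.mem_sup.1 (ih.ge (Submodule.mem_top : x ∈ ⊤))
      obtain ⟨b, hb, w, hw, rfl⟩ := Submodule.mem_sup.1 (ih.ge (Submodule.mem_top : y ∈ ⊤))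
      have hexp : ⁅a + z, b + w⁆ = ⁅a, b⁆ + (⁅a + z, w⁆ - ⁅b, z⁆) := by
        rw [← lie_skew b z]; simp only [add_lie, lie_add]; abel
      change ⁅a + z, b + w⁆ ∈ _
      rw [hexp]
      exact Submodule.add_mem_sup (hG a ha b hb)
        (Submodule.sub_mem _ (hlow _ w hw) (hlow _ z hz))
  have := key s
  rwa [hs, LieSubmodule.bot_toSubmodule, sup_bot_eq] at this

theorem span_nestedBracket_eq_top {s : ℕ} (hs : LieModule.lowerCentralSeries ℂ N N s = ⊥)
    (e : ι → N) (hsup : Submodule.span ℂ (Set.range e) ⊔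
      (⁅(⊤ : LieIdeal ℂ N), (⊤ : LieIdeal ℂ N)⁆ : LieIdeal ℂ N).toSubmodule = ⊤) :
    Submodule.span ℂ (nestedBracket e '' {l | l ≠ []}) = ⊤ := by
  refine eq_top_of_sup_lie_eq_top hs _ (fun x hx y hy => lie_mem_span_nestedBracket e x y hx hy)
    (eq_top_iff.2 (hsup.ge.trans (sup_le_sup_right ?_ _)))
  refine Submodule.span_mono ?_
  rintro _ ⟨i, rfl⟩
  exact ⟨[i], List.cons_ne_nil _ _, rfl⟩

end NestedBracket

/-! ### Generating weight vectors of a Lie algebra of maximal rank -/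

theorem exists_span_sup_eq_top {V : Type*} [AddCommGroup V] [Module ℂ V] [FiniteDimensional ℂ V]
    (I : Submodule ℂ V) {W : Set V} (hW : Submodule.span ℂ W = ⊤) :
    ∃ e : Fin (Module.finrank ℂ (V ⧸ I)) → V, (∀ i, e i ∈ W) ∧
      Submodule.span ℂ (Set.range e) ⊔ I = ⊤ := by
  have hspan : ⊤ ≤ Submodule.span ℂ (I.mkQ '' W) := by
    rw [← Submodule.map_span, hW, Submodule.map_top, Submodule.range_mkQ]
  let b' := Module.Basis.ofSpan hspan
  have hfin : Fintype _ := FiniteDimensional.fintypeBasisIndex b'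
  let b := b'.reindex (Fintype.equivFinOfCardEq (Module.finrank_eq_card_basis b').symm)
  have hb : ∀ i, ∃ x ∈ W, I.mkQ x = b i := fun i => by
    rw [Module.Basis.reindex_apply]
    exact Module.Basis.ofSpan_subset hspan ⟨_, rfl⟩
  choose e he hπe using hb
  refine ⟨e, he, ?_⟩
  have hcm := Submodule.comap_map_eq I.mkQ (Submodule.span ℂ (Set.range e))
  rw [I.ker_mkQ] at hcm
  rw [← hcm, Submodule.map_span, ← Set.range_comp,
    show I.mkQ ∘ e = b from funext hπe, b.span_eq, Submodule.comap_top]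

section Generators

variable {N : Type*} [LieRing N] [LieAlgebra ℂ N]

/-- The `e i` are weight vectors of weights `α i` that generate `N`, in the sense that their
right-normed brackets span it, and the weights `α i` take arbitrary prescribed values on `T`. -/
structure IsWeightGenerating (T : LieSubalgebra ℂ (LieDerivation ℂ N N)) {ι : Type*} (e : ι → N)
    (α : ι → Module.Dual ℂ T) : Prop where
  generator_mem : ∀ i, e i ∈ weightSpace (torusOnN T) (α i)
  span_eq_top : Submodule.span ℂ (nestedBracket e '' {l | l ≠ []}) = ⊤
  exists_eq : ∀ c : ι → ℂ, ∃ t, ∀ i, α i t = c i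

variable {T : LieSubalgebra ℂ (LieDerivation ℂ N N)} {ι : Type*} {e : ι → N}
  {α : ι → Module.Dual ℂ T}

theorem lie_mem_weightSpace {β γ : Module.Dual ℂ T} {x y : N}
    (hx : x ∈ weightSpace (torusOnN T) β) (hy : y ∈ weightSpace (torusOnN T) γ) :
    ⁅x, y⁆ ∈ weightSpace (torusOnN T) (β + γ) := by
  rw [mem_weightSpace] at hx hy ⊢
  intro t
  have h : torusOnN T t ⁅x, y⁆ = ⁅x, torusOnN T t y⁆ + ⁅torusOnN T t x, y⁆ :=
    (t : LieDerivation ℂ N N).apply_lie_eq_add x y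
  rw [h, hx, hy, lie_smul, smul_lie, LinearMap.add_apply, add_smul, add_comm]

theorem nestedBracket_mem_weightSpace (he : ∀ i, e i ∈ weightSpace (torusOnN T) (α i))
    (l : List ι) : nestedBracket e l ∈ weightSpace (torusOnN T) (l.map α).sum := by
  induction l with
  | nil => exact Submodule.zero_mem _
  | cons i l ih =>
    by_cases hl : l = []
    · subst hl; simpa using! he i
    · rw [nestedBracket_cons e i hl, List.map_cons, List.sum_cons]
      exact lie_mem_weightSpace (he i) ih

/-- The weights of generators separate the points of `T`, and by the equality of dimensions they are
then coordinates on `T`. -/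
theorem IsTorus.exists_isWeightGenerating [FiniteDimensional ℂ N] (hT : IsTorus T)
    (hrank : Module.finrank ℂ T =
      Module.finrank ℂ (N ⧸ (⁅(⊤ : LieIdeal ℂ N), (⊤ : LieIdeal ℂ N)⁆ : LieIdeal ℂ N)))
    {s : ℕ} (hs : LieModule.lowerCentralSeries ℂ N N s = ⊥) :
    ∃ (n : ℕ) (e : Fin n → N) (α : Fin n → Module.Dual ℂ T), IsWeightGenerating T e α := by
  let W : Set N := {x | ∃ β, x ∈ weightSpace (torusOnN T) β}
  have hW : Submodule.span ℂ W = ⊤ := by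
    rw [eq_top_iff, ← iSup_weightSpace hT.torusOnN_mul_comm hT.isSemisimple_torusOnN]
    exact iSup_le fun β x hx => Submodule.subset_span ⟨β, hx⟩
  obtain ⟨e, heW, hsup⟩ := exists_span_sup_eq_top
    (⁅(⊤ : LieIdeal ℂ N), (⊤ : LieIdeal ℂ N)⁆ : LieIdeal ℂ N).toSubmodule hW
  choose α he using heW
  have hgen := span_nestedBracket_eq_top hs e hsup
  refine ⟨_, e, α, he, hgen, ?_⟩
  let X : T →ₗ[ℂ] (Fin _ → ℂ) := LinearMap.pi α
  have hinj : Function.Injective X := by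
    rw [← LinearMap.ker_eq_bot, LinearMap.ker_eq_bot']
    intro t ht
    have ht' : ∀ i, α i t = 0 := fun i => congrFun ht i
    have hzero : torusOnN T t = 0 := by
      refine LinearMap.ext_on hgen ?_
      rintro _ ⟨l, -, rfl⟩
      rw [mem_weightSpace.1 (nestedBracket_mem_weightSpace he l) t]
      have : (l.map α).sum t = 0 := by
        induction l with
        | nil => rfl
        | cons i l ih => simp [ht', ih]
      rw [this, zero_smul]; rfl
    exact Subtype.ext (LieDerivation.ext fun x => congrArg (fun u => u x) hzero)
  have hsurj : Function.Surjective X :=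
    (LinearMap.injective_iff_surjective_of_finrank_eq_finrank (by
      rw [Module.finrank_fin_fun]; exact hrank)).1 hinj
  intro c
  obtain ⟨t, ht⟩ := hsurj c
  exact ⟨t, fun i => congrFun ht i⟩

theorem IsWeightGenerating.exists_of_mem_weights (h : IsWeightGenerating T e α)
    (hc : ∀ t t', torusOnN T t * torusOnN T t' = torusOnN T t' * torusOnN T t)
    {β : Module.Dual ℂ T} (hβ : β ∈ weights (torusOnN T)) :
    ∃ l : List ι, nestedBracket e l ≠ 0 ∧ (l.map α).sum = β := by
  by_contra! hno
  apply hβ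
  have htop : ⨆ γ, ⨆ (_ : γ ≠ β), weightSpace (torusOnN T) γ = ⊤ := by
    rw [eq_top_iff, ← h.span_eq_top, Submodule.span_le]
    rintro _ ⟨l, -, rfl⟩
    by_cases hl : nestedBracket e l = 0
    · rw [hl]; exact Submodule.zero_mem _
    · exact Submodule.mem_iSup_of_mem _ (Submodule.mem_iSup_of_mem (hno l hl)
        (nestedBracket_mem_weightSpace h.generator_mem l))
  have := iSupIndep_weightSpace hc β
  rwa [htop, disjoint_top] at this

theorem sum_map_apply (l : List ι) (t : T) : (l.map α).sum t = (l.map fun i => α i t).sum := by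
  induction l with
  | nil => rfl
  | cons i l ih => simp [ih]

theorem IsWeightGenerating.add_eq_add (h : IsWeightGenerating T e α) {i j a b : ι} (hij : i ≠ j)
    (hab : α a + α b = α i + α j) : a = i ∧ b = j ∨ a = j ∧ b = i := by
  classical
  obtain ⟨t, ht⟩ := h.exists_eq (fun k => if k = i then 1 else 0)
  obtain ⟨t', ht'⟩ := h.exists_eq (fun k => if k = j then 1 else 0)
  have h1 := congrArg (fun u : Module.Dual ℂ T => u t) hab
  have h2 := congrArg (fun u : Module.Dual ℂ T => u t') hab
  simp only [LinearMap.add_apply, ht, ht', if_true, if_neg hij, if_neg hij.symm] at h1 h2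
  by_cases hai : a = i
  · subst hai
    by_cases hbj : b = j
    · exact Or.inl ⟨rfl, hbj⟩
    · simp [hij, hbj] at h2
  · by_cases hbi : b = i
    · subst hbi
      by_cases haj : a = j
      · exact Or.inr ⟨haj, rfl⟩
      · simp [hij, haj] at h2
    · simp [hai, hbi] at h1

theorem IsWeightGenerating.ne_add (h : IsWeightGenerating T e α) (i j k : ι) :
    α k ≠ α i + α j := fun hk => by
  obtain ⟨t, ht⟩ := h.exists_eq (fun _ => 1)
  have h1 := congrArg (fun u : Module.Dual ℂ T => u t) hk
  simp [ht] at h1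

end Generators

/-! ### Invariant cochains of degree at least the nilpotency length -/

theorem eq_zero_of_forall_mem_span {L M : Type*} [LieRing L] [LieAlgebra ℂ L] [AddCommGroup M]
    [Module ℂ M] {S : Set L} (hS : Submodule.span ℂ S = ⊤) {k : ℕ} (f : L [⋀^Fin k]→ₗ[ℂ] M)
    (h : ∀ v, (∀ i, v i ∈ S) → f v = 0) : f = 0 := by
  induction k with
  | zero => ext v; exact h v fun i => i.elim0
  | succ k ih =>
    refine cochain_ext fun x => ?_
    have hx : x ∈ Submodule.span ℂ S := by rw [hS]; trivial
    induction hx using Submodule.span_induction with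
    | mem x hx =>
      exact ih _ fun v hv => h _ fun i => by cases i using Fin.cases <;> simp [hx, hv]
    | zero => rw [map_zero, map_zero]
    | add x y _ _ hx hy => rw [map_add, map_add, hx, hy]
    | smul c x _ hx => rw [map_smul, map_smul, hx]

theorem invariant_apply {L M : Type*} [LieRing L] [LieAlgebra ℂ L] [AddCommGroup M] [Module ℂ M]
    {D : Module.End ℂ L} {E : Module.End ℂ M} {k : ℕ} {f : L [⋀^Fin k]→ₗ[ℂ] M}
    (hf : cochainAction D E k f = 0) {v : Fin k → L} {c : Fin k → ℂ}
    (hv : ∀ i, D (v i) = c i • v i) : E (f v) = (∑ i, c i) • f v := by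
  have h := congrArg (fun u => u v) hf
  simp only [cochainAction_apply, AlternatingMap.zero_apply, sub_eq_zero] at h
  rw [h, Finset.sum_smul]
  refine Finset.sum_congr rfl fun i _ => ?_
  rw [hv, AlternatingMap.map_update_smul, Function.update_eq_self]

/-- Moving the `q`-th argument of a cochain to the front. -/
theorem apply_eq_contract {L M : Type*} [LieRing L] [LieAlgebra ℂ L] [AddCommGroup M]
    [Module ℂ M] {k : ℕ} (f : L [⋀^Fin (k + 1)]→ₗ[ℂ] M) (v : Fin (k + 1) → L) (q : Fin (k + 1)) :
    f v = (-1 : ℂ) ^ (q : ℕ) • f.curryLeft (v q) (q.removeNth v) := by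
  have h := f.map_insertNth q (v q) (q.removeNth v)
  rw [Fin.insertNth_removeNth, Function.update_eq_self] at h
  rw [h, ← Int.cast_smul_eq_zsmul ℂ]
  push_cast; rfl

/-- A cochain vanishes at `v` if and only if it vanishes after two of the arguments have been
moved to the front. -/
theorem contract_contract_eq_zero_iff {L M : Type*} [LieRing L] [LieAlgebra ℂ L] [AddCommGroup M]
    [Module ℂ M] {k : ℕ} (f : L [⋀^Fin (k + 2)]→ₗ[ℂ] M) (v : Fin (k + 2) → L) (q : Fin (k + 2))
    (p : Fin (k + 1)) : (f.curryLeft (v q)).curryLeft (v (q.succAbove p))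
      (p.removeNth (q.removeNth v)) = 0 ↔ f v = 0 := by
  rw [apply_eq_contract f v q, apply_eq_contract (f.curryLeft (v q)) (q.removeNth v) p]
  simp [Fin.removeNth]

section InvariantCochains

variable {N : Type*} [LieRing N] [LieAlgebra ℂ N] {T : LieSubalgebra ℂ (LieDerivation ℂ N N)}
  {M : Type*} [AddCommGroup M] [Module ℂ M] [LieRingModule (Extension T) M]
  [LieModule ℂ (Extension T) M] {ι : Type*} {e : ι → N} {α : ι → Module.Dual ℂ T}

/-- If an invariant cochain is nonzero on right-normed brackets along the lists `l i`, then some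
nonzero right-normed bracket has the sum of their weights as its weight and the sum of their
lengths as its length. -/
theorem IsWeightGenerating.exists_weight_of_apply_ne_zero (h : IsWeightGenerating T e α)
    (hT : IsTorus T)
    (hM : ∀ μ ∈ weights (torusOnModule T M), μ = 0 ∨ μ ∈ weights (torusOnN T)) {k : ℕ}
    {f : N [⋀^Fin k]→ₗ[ℂ] M}
    (hf : ∀ t, cochainAction (torusOnN T t) (torusOnModule T M t) k f = 0) {l : Fin k → List ι}
    (hfl : f (fun i => nestedBracket e (l i)) ≠ 0) (hk : ∑ i, (l i).length ≠ 0) :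
    ∃ l', nestedBracket e l' ≠ 0 ∧ (l'.map α).sum = ∑ i, ((l i).map α).sum ∧
      l'.length = ∑ i, (l i).length := by
  have hμ := hM _ (mem_weights_of_apply (α := ∑ i, ((l i).map α).sum) hfl fun t => by
    rw [LinearMap.sum_apply]
    exact invariant_apply (hf t) fun i =>
      mem_weightSpace.1 (nestedBracket_mem_weightSpace h.generator_mem (l i)) t)
  -- The element of `T` on which all `α i` are `1` measures the degree of a weight.
  obtain ⟨t, ht⟩ := h.exists_eq (fun _ => 1)
  have hlen : ∀ l : List ι, (l.map α).sum t = l.length := fun l => by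
    rw [sum_map_apply]; simp [ht]
  have hsum : (∑ i, ((l i).map α).sum) t = ((∑ i, (l i).length : ℕ) : ℂ) := by
    rw [LinearMap.sum_apply]; simp [hlen]
  rcases hμ with h0 | hμ
  · rw [h0, LinearMap.zero_apply] at hsum
    exact absurd (by exact_mod_cast hsum.symm) hk
  · obtain ⟨l', hl', hl'sum⟩ := h.exists_of_mem_weights hT.torusOnN_mul_comm hμ
    refine ⟨l', hl', hl'sum, ?_⟩
    have := congrArg (fun u : Module.Dual ℂ T => u t) hl'sum
    simp only [hlen, hsum] at this
    exact_mod_cast this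

/-- An invariant cochain of degree `k ≥ s` that is nonzero on some right-normed brackets has degree
`s`, and these brackets are generators. -/
theorem IsWeightGenerating.length_eq_one (h : IsWeightGenerating T e α)
    (hT : IsTorus T)
    (hM : ∀ μ ∈ weights (torusOnModule T M), μ = 0 ∨ μ ∈ weights (torusOnN T)) {k s : ℕ}
    (hs : LieModule.lowerCentralSeries ℂ N N s = ⊥) (hsk : s ≤ k) {f : N [⋀^Fin k]→ₗ[ℂ] M}
    (hf : ∀ t, cochainAction (torusOnN T t) (torusOnModule T M t) k f = 0) {l : Fin k → List ι}
    (hl : ∀ i, l i ≠ []) (hfl : f (fun i => nestedBracket e (l i)) ≠ 0) (hk : 0 < k) :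
    k = s ∧ ∀ i, (l i).length = 1 := by
  have hpos : ∀ i ∈ Finset.univ, 1 ≤ (l i).length := fun i _ => List.length_pos_iff.2 (hl i)
  have hge : ∑ _i : Fin k, 1 ≤ ∑ i, (l i).length := Finset.sum_le_sum hpos
  have hge' : k ≤ ∑ i, (l i).length := by simpa using hge
  obtain ⟨l', hl', -, hlen⟩ := h.exists_weight_of_apply_ne_zero hT hM hf hfl (by omega)
  have hle := length_le_of_nestedBracket_ne_zero e hs hl'
  refine ⟨by omega, fun i => ?_⟩
  have heq : ∑ _i : Fin k, 1 = ∑ i, (l i).length := by simp; omega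
  exact ((Finset.sum_eq_sum_iff_of_le hpos).1 heq i (Finset.mem_univ i)).symm

theorem IsWeightGenerating.eq_zero_of_lt (h : IsWeightGenerating T e α)
    (hT : IsTorus T)
    (hM : ∀ μ ∈ weights (torusOnModule T M), μ = 0 ∨ μ ∈ weights (torusOnN T)) {k s : ℕ}
    (hs : LieModule.lowerCentralSeries ℂ N N s = ⊥) (hsk : s < k) {f : N [⋀^Fin k]→ₗ[ℂ] M}
    (hf : ∀ t, cochainAction (torusOnN T t) (torusOnModule T M t) k f = 0) : f = 0 := by
  refine eq_zero_of_forall_mem_span h.span_eq_top f fun v hv => ?_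
  choose l hl hlv using hv
  obtain rfl : (fun i => nestedBracket e (l i)) = v := funext hlv
  by_contra hne
  exact absurd (h.length_eq_one hT hM hs hsk.le hf hl hne (by omega)).1 (by omega)

theorem IsWeightGenerating.eq_zero_of_generators (h : IsWeightGenerating T e α)
    (hT : IsTorus T)
    (hM : ∀ μ ∈ weights (torusOnModule T M), μ = 0 ∨ μ ∈ weights (torusOnN T)) {s : ℕ}
    (hs : LieModule.lowerCentralSeries ℂ N N s = ⊥) (hs0 : 0 < s) {f : N [⋀^Fin s]→ₗ[ℂ] M}
    (hf : ∀ t, cochainAction (torusOnN T t) (torusOnModule T M t) s f = 0)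
    (h0 : ∀ a : Fin s → ι, f (e ∘ a) = 0) : f = 0 := by
  refine eq_zero_of_forall_mem_span h.span_eq_top f fun v hv => ?_
  choose l hl hlv using hv
  obtain rfl : (fun i => nestedBracket e (l i)) = v := funext hlv
  by_contra hne
  have hlen := (h.length_eq_one hT hM hs le_rfl hf hl hne hs0).2
  choose a ha using fun i => List.length_eq_one_iff.1 (hlen i)
  refine hne ?_
  rw [← h0 a]
  exact congrArg f (funext fun i => by rw [ha]; rfl)

theorem sum_map_ite [DecidableEq ι] (i : ι) (l : List ι) :
    (l.map fun k => if k = i then (1 : ℂ) else 0).sum = l.count i := by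
  induction l with
  | nil => simp
  | cons k l ih => simp [ih, List.count_cons, add_comm]

/-- If an invariant cochain of degree at least `2` is nonzero on a tuple of generators, then two of
these generators do not commute. -/
theorem IsWeightGenerating.exists_lie_ne_zero (h : IsWeightGenerating T e α)
    (hT : IsTorus T)
    (hM : ∀ μ ∈ weights (torusOnModule T M), μ = 0 ∨ μ ∈ weights (torusOnN T)) {s : ℕ}
    (hs2 : 2 ≤ s) {f : N [⋀^Fin s]→ₗ[ℂ] M}
    (hf : ∀ t, cochainAction (torusOnN T t) (torusOnModule T M t) s f = 0)
    {a : Fin s → ι} (ha : f (e ∘ a) ≠ 0) : ∃ p q, ⁅e (a p), e (a q)⁆ ≠ 0 := by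
  classical
  obtain ⟨l, hl, hsum, hlen⟩ := h.exists_weight_of_apply_ne_zero hT hM hf (l := fun i => [a i])
    ha (by simp; omega)
  have hmem : ∀ i ∈ l, ∃ p, a p = i := fun i hi => by
    by_contra! hno
    obtain ⟨t, ht⟩ := h.exists_eq (fun k => if k = i then 1 else 0)
    have h1 := congrArg (fun u : Module.Dual ℂ T => u t) hsum
    simp only [LinearMap.sum_apply, sum_map_apply, ht] at h1
    rw [sum_map_ite] at h1
    simp [hno] at h1
    exact List.count_eq_zero.1 h1 hi
  obtain ⟨i, hi, j, hj, hij⟩ := exists_lie_ne_zero_of_nestedBracket e (by simpa [hlen] using hs2) hl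
  obtain ⟨p, rfl⟩ := hmem i hi
  obtain ⟨q, rfl⟩ := hmem j hj
  exact ⟨p, q, hij⟩

end InvariantCochains

section TopDegree
variable {L M : Type*} [LieRing L] [LieAlgebra ℂ L] [AddCommGroup M] [Module ℂ M]

theorem wedge_apply_of_eq_zero (ψ : L →ₗ[ℂ] ℂ) {k : ℕ} (u : L [⋀^Fin k]→ₗ[ℂ] M)
    (v : Fin (k + 1) → L) (hv : ∀ i, ψ (v i) = 0) : wedge ψ u v = 0 := by
  simp [wedge_apply, hv]

theorem wedge_cons_of_eq_zero (ψ : L →ₗ[ℂ] ℂ) {k : ℕ} (u : L [⋀^Fin k]→ₗ[ℂ] M)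
    (x : L) (v : Fin k → L) (hv : ∀ i, ψ (v i) = 0) : wedge ψ u (Fin.cons x v) = ψ x • u v := by
  rw [wedge_apply, Fin.sum_univ_succ]
  simp [hv]

/-- The differential of `ψ ∧ u` on arguments in the kernel of `ψ`. -/
theorem differential_wedge_apply_of_eq_zero (ρ : L →ₗ⁅ℂ⁆ Module.End ℂ M) (ψ : L →ₗ[ℂ] ℂ) {k : ℕ}
    (u : L [⋀^Fin k]→ₗ[ℂ] M) (v : Fin (k + 2) → L) (hv : ∀ i, ψ (v i) = 0) :
    differential ρ (k + 1) (wedge ψ u) v =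
      ∑ q : Fin (k + 2), ∑ p : Fin (k + 1), if p.castSucc < q then
        (-1 : ℂ) ^ ((p : ℕ) + (q : ℕ)) • ψ ⁅v p.castSucc, v q⁆ • u (p.removeNth (q.removeNth v))
      else 0 := by
  rw [differential_succ_apply]
  have h0 : ∀ i : Fin (k + 2), wedge ψ u (i.removeNth v) = 0 := fun i =>
    wedge_apply_of_eq_zero ψ u _ fun j => hv _
  simp only [h0, map_zero, smul_zero, Finset.sum_const_zero, zero_add]
  refine Finset.sum_congr rfl fun q _ => Finset.sum_congr rfl fun p _ => ?_
  rw [wedge_cons_of_eq_zero ψ u _ (p.removeNth (q.removeNth v)) fun j => hv _]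

end TopDegree

section TopDegreeVanishing

variable {N : Type*} [LieRing N] [LieAlgebra ℂ N] {T : LieSubalgebra ℂ (LieDerivation ℂ N N)}
  {M : Type*} [AddCommGroup M] [Module ℂ M] [LieRingModule (Extension T) M]
  [LieModule ℂ (Extension T) M] {ι : Type*} {e : ι → N} {α : ι → Module.Dual ℂ T}

theorem wedge_smul (ψ : N →ₗ[ℂ] ℂ) {k : ℕ} (c : ℂ) (u : N [⋀^Fin k]→ₗ[ℂ] M) :
    wedge ψ (c • u) = c • wedge ψ u := by
  ext v
  simp only [wedge_apply, AlternatingMap.smul_apply, Finset.smul_sum, smul_comm c]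

theorem smul_wedge (ψ : N →ₗ[ℂ] ℂ) {k : ℕ} (c : ℂ) (u : N [⋀^Fin k]→ₗ[ℂ] M) :
    wedge (c • ψ) u = c • wedge ψ u := by
  ext v
  simp only [wedge_apply, AlternatingMap.smul_apply, Finset.smul_sum, LinearMap.smul_apply,
    smul_assoc, smul_comm c]

/-- If the weights of `M` are zero or weights of `N`, every invariant cochain of degree equal to the
nilpotency length is a coboundary. The proof is by induction on the number of tuples of
generators on which the cochain is nonzero. -/
theorem IsWeightGenerating.mem_coboundaries [FiniteDimensional ℂ N] [Fintype ι]
    (h : IsWeightGenerating T e α) (hT : IsTorus T)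
    (hM : ∀ μ ∈ weights (torusOnModule T M), μ = 0 ∨ μ ∈ weights (torusOnN T))
    (hMs : ∀ t, (torusOnModule T M t).IsSemisimple) [FiniteDimensional ℂ M] {m : ℕ}
    (hs : LieModule.lowerCentralSeries ℂ N N (m + 2) = ⊥) {f : N [⋀^Fin (m + 2)]→ₗ[ℂ] M}
    (hf : ∀ t, cochainAction (torusOnN T t) (torusOnModule T M t) (m + 2) f = 0) :
    f ∈ coboundaries (nilOnModule T M) (m + 2) := by
  classical
  induction hn : (Finset.univ.filter fun a : Fin (m + 2) → ι => f (e ∘ a) ≠ 0).card using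
    Nat.strong_induction_on generalizing f with
  | _ n ih =>
  subst hn
  by_cases h0 : ∀ a : Fin (m + 2) → ι, f (e ∘ a) = 0
  · rw [h.eq_zero_of_generators hT hM hs (by omega) hf h0]
    exact Submodule.zero_mem _
  push Not at h0
  obtain ⟨a₀, ha₀⟩ := h0
  obtain ⟨p₀, q₀, hpq⟩ := h.exists_lie_ne_zero hT hM (by omega) hf ha₀
  obtain ⟨r, rfl⟩ : ∃ r, q₀.succAbove r = p₀ := Fin.exists_succAbove_eq fun hh => hpq (by
    rw [hh, lie_self])
  set i := a₀ (q₀.succAbove r) with hi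
  set j := a₀ q₀ with hj
  have hij : i ≠ j := fun hh => hpq (by rw [hh, lie_self])
  set rest : Fin m → ι := r.removeNth (q₀.removeNth a₀) with hrest
  set u := (f.curryLeft (e i)).curryLeft (e j) with hu
  have hu0 : u (e ∘ rest) ≠ 0 := by
    rw [hu, contract_contract, AlternatingMap.neg_apply, neg_ne_zero]
    exact fun hh => ha₀ ((contract_contract_eq_zero_iff f (e ∘ a₀) q₀ r).1 hh)
  obtain ⟨ψ, hψ1, hψt, hψ0⟩ := exists_functional_of_weight hT.torusOnN_mul_comm
    hT.isSemisimple_torusOnN (α i + α j) hpq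
    (lie_mem_weightSpace (h.generator_mem i) (h.generator_mem j))
  have hψe : ∀ k, ψ (e k) = 0 := fun k => hψ0 _ (h.ne_add i j k) _ (h.generator_mem k)
  have hψlie : ∀ a b, ψ ⁅e a, e b⁆ ≠ 0 → a = i ∧ b = j ∨ a = j ∧ b = i := fun a b hab => by
    refine h.add_eq_add hij ?_
    by_contra hne
    exact hab (hψ0 _ hne _ (lie_mem_weightSpace (h.generator_mem a) (h.generator_mem b)))
  set g := wedge ψ u with hg
  have hginv : ∀ t, cochainAction (torusOnN T t) (torusOnModule T M t) (m + 1) g = 0 := fun t => by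
    have h1 := contract_cochainAction (torusOnN T t) (torusOnModule T M t) f (e i)
    have h2 := contract_cochainAction (torusOnN T t) (torusOnModule T M t) (f.curryLeft (e i)) (e j)
    rw [hf, mem_weightSpace.1 (h.generator_mem i), map_smul,
      AlternatingMap.curryLeft_zero, LinearMap.zero_apply, eq_comm, sub_eq_zero] at h1
    rw [h1, mem_weightSpace.1 (h.generator_mem j), map_smul, contract_smul, eq_comm,
      sub_eq_iff_eq_add] at h2
    have hψD : ψ ∘ₗ torusOnN T t = (α i + α j) t • ψ := LinearMap.ext fun x => hψt t x
    rw [hg, cochainAction_wedge, hψD, smul_wedge, h2, ← add_smul, wedge_smul,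
      LinearMap.add_apply, sub_self]
  have hval : ∀ a : Fin (m + 2) → ι, differential (nilOnModule T M) (m + 1) g (e ∘ a) = _ :=
    fun a => differential_wedge_apply_of_eq_zero (nilOnModule T M) ψ u (e ∘ a) fun k => hψe _
  -- Passing from `f` to `f + d g` creates no new nonzero values on tuples of generators, …
  have hzero : ∀ a : Fin (m + 2) → ι, f (e ∘ a) = 0 →
      differential (nilOnModule T M) (m + 1) g (e ∘ a) = 0 := fun a ha => by
    rw [hval]
    refine Finset.sum_eq_zero fun q _ => Finset.sum_eq_zero fun p _ => ?_
    split_ifs with hlt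
    · by_cases hψ : ψ ⁅(e ∘ a) p.castSucc, (e ∘ a) q⁆ = 0
      · rw [hψ, zero_smul, smul_zero]
      · have hz : u (p.removeNth (q.removeNth (e ∘ a))) = 0 := by
          have h1 := (contract_contract_eq_zero_iff f (e ∘ a) q p).2 ha
          rw [Fin.succAbove_of_castSucc_lt _ _ hlt] at h1
          simp only [Function.comp_apply] at h1
          rcases hψlie _ _ hψ with ⟨h2, h3⟩ | ⟨h2, h3⟩
          · rw [hu, contract_contract, AlternatingMap.neg_apply, ← h2, ← h3, h1, neg_zero]
          · rw [hu, ← h2, ← h3, h1]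
        rw [hz, smul_zero, smul_zero]
    · rfl
  -- … and it removes the value on the tuple that starts with `i`, `j`.
  have hcancel : ∃ a : Fin (m + 2) → ι, f (e ∘ a) ≠ 0 ∧
      differential (nilOnModule T M) (m + 1) g (e ∘ a) = - f (e ∘ a) := by
    set a : Fin (m + 2) → ι := Fin.cons i (Fin.cons j rest) with ha
    have hau : f (e ∘ a) = u (e ∘ rest) := by
      refine congrArg f (funext fun k => ?_)
      cases k using Fin.cases with
      | zero => rfl
      | succ k => cases k using Fin.cases <;> rfl
    have hne : f (e ∘ a) ≠ 0 := by rw [hau]; exact hu0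
    have hinj : Function.Injective a := fun x y hxy => by
      by_contra hxy'
      exact hne (f.map_eq_zero_of_eq (e ∘ a) (congrArg e hxy) hxy')
    refine ⟨a, hne, ?_⟩
    rw [hval, Finset.sum_eq_single 1, Finset.sum_eq_single 0]
    · have hr : (0 : Fin (m + 1)).removeNth ((1 : Fin (m + 2)).removeNth (e ∘ a)) = e ∘ rest := by
        funext k
        have : (1 : Fin (m + 2)).succAbove k.succ = k.succ.succ := by
          rw [← Fin.succ_zero_eq_one, Fin.succ_succAbove_succ, Fin.zero_succAbove]
        simp [Fin.removeNth, this, ha]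
      rw [hr, hau]
      have : ψ ⁅(e ∘ a) (Fin.castSucc 0), (e ∘ a) 1⁆ = 1 := hψ1
      rw [this]
      simp
    · intro p _ hp
      refine if_neg fun hlt => hp (Fin.ext ?_)
      have : (p : ℕ) < 1 := by simpa [Fin.lt_def] using hlt
      simpa using this
    · simp
    · intro q _ hq
      refine Finset.sum_eq_zero fun p _ => ?_
      split_ifs with hlt
      · have : ψ ⁅(e ∘ a) p.castSucc, (e ∘ a) q⁆ = 0 := by
          by_contra hψ
          have ha0 : a 0 = i := rfl
          have ha1 : a 1 = j := rfl
          rcases hψlie _ _ hψ with ⟨h2, h3⟩ | ⟨h2, h3⟩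
          · exact hq (hinj (h3.trans ha1.symm))
          · rw [hinj (h3.trans ha0.symm)] at hlt
            exact absurd hlt (Fin.not_lt_zero _)
        rw [this, zero_smul, smul_zero]
      · rfl
    · simp
  obtain ⟨a, ha, hda⟩ := hcancel
  have hg' : differential (nilOnModule T M) (m + 1) g ∈ coboundaries (nilOnModule T M) (m + 2) :=
    ⟨g, rfl⟩
  have hact := hT.isTorusAction_nil hMs
  have hmem := ih _ ?_ (f := f + differential (nilOnModule T M) (m + 1) g) (fun t => by
    rw [map_add, hf, cochainAction_differential _ _ _ (hact.leibniz t) (hact.compat t), hginv,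
      map_zero, add_zero]) rfl
  · have := Submodule.sub_mem _ hmem hg'
    rwa [add_sub_cancel_right] at this
  · refine Finset.card_lt_card (Finset.ssubset_iff_of_subset ?_ |>.2 ⟨a, ?_, ?_⟩)
    · intro b hb
      simp only [Finset.mem_filter, Finset.mem_univ, true_and] at hb ⊢
      intro hb0
      exact hb (by rw [AlternatingMap.add_apply, hb0, hzero b hb0, add_zero])
    · simpa using ha
    · simp [hda]

end TopDegreeVanishing

/-! ### The modules in question -/

theorem isSemisimple_of_actsDiagonally {S V : Type*} [AddCommGroup S] [Module ℂ S]
    [AddCommGroup V] [Module ℂ V] [FiniteDimensional ℂ V] {θ : S →ₗ[ℂ] Module.End ℂ V}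
    (h : ActsDiagonally θ) (t : S) : (θ t).IsSemisimple := by
  refine isSemisimple_of_iSup_eigenspace _ (eq_top_iff.2 ?_)
  rw [← show ⨆ α, weightSpace θ α = ⊤ from h]
  exact iSup_le fun α => (iInf_le _ t).trans (le_iSup (fun μ : ℂ => (θ t).eigenspace μ) (α t))

theorem IsTorus.weights_adjoint {N : Type*} [LieRing N] [LieAlgebra ℂ N]
    {T : LieSubalgebra ℂ (LieDerivation ℂ N N)} (hT : IsTorus T)
    {μ : Module.Dual ℂ T} (hμ : μ ∈ weights (torusOnModule T (Extension T))) :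
    μ = 0 ∨ μ ∈ weights (torusOnN T) := by
  obtain ⟨v, hv, hv0⟩ := Submodule.exists_mem_ne_zero_of_ne_bot hμ
  rw [mem_weightSpace] at hv
  by_cases hn : v.left = 0
  · left
    ext t
    have h1 := congrArg LieAlgebra.SemiDirectSum.right (hv t)
    have h2 : (torusOnModule T (Extension T) t v).right = ⁅t, v.right⁆ := rfl
    rw [h2, hT.commute] at h1
    have h3 : μ t • v.right = 0 := h1.symm
    rcases smul_eq_zero.1 h3 with h | h
    · exact h
    · exact absurd (LieAlgebra.SemiDirectSum.ext hn h) hv0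
  · right
    refine mem_weights_of_apply hn fun t => ?_
    have h1 := congrArg LieAlgebra.SemiDirectSum.left (hv t)
    have h2 : (torusOnModule T (Extension T) t v).left = torusOnN T t v.left := by
      have : torusOnModule T (Extension T) t v =
        ⁅LieAlgebra.SemiDirectSum.inr T.incl t, v⁆ := rfl
      rw [this]
      simp [torusOnN_apply]
    rw [h2] at h1
    exact h1

end MaxRank

end

theorem corollary3p6
    {N : Type*} [LieRing N] [LieAlgebra ℂ N] [FiniteDimensional ℂ N] [LieRing.IsNilpotent N]
    (T : LieSubalgebra ℂ (LieDerivation ℂ N N)) (hT : MaxRank.IsMaximalTorus T)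
    (hrank : Module.finrank ℂ T =
      Module.finrank ℂ (N ⧸ (⁅(⊤ : LieIdeal ℂ N), (⊤ : LieIdeal ℂ N)⁆ : LieIdeal ℂ N)))
    (hdim : ∀ α ∈ MaxRank.weights (MaxRank.torusOnN T),
      Module.finrank ℂ (MaxRank.weightSpace (MaxRank.torusOnN T) α) = 1)
    (hbracket : ∀ α ∈ MaxRank.weights (MaxRank.torusOnN T),
      ∀ β ∈ MaxRank.weights (MaxRank.torusOnN T),
      α ≠ β → α + β ∈ MaxRank.weights (MaxRank.torusOnN T) →
      Submodule.span ℂ {z : N | ∃ x ∈ MaxRank.weightSpace (MaxRank.torusOnN T) α,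
        ∃ y ∈ MaxRank.weightSpace (MaxRank.torusOnN T) β, ⁅x, y⁆ = z} =
        MaxRank.weightSpace (MaxRank.torusOnN T) (α + β))
    (s : ℕ) (hs : 2 ≤ s) (hnil : MaxRank.nilindex N = s + 1) :
    (∀ (M : Type*) [AddCommGroup M] [Module ℂ M] [LieRingModule (MaxRank.Extension T) M]
      [LieModule ℂ (MaxRank.Extension T) M] [FiniteDimensional ℂ M],
      MaxRank.ActsDiagonally (MaxRank.torusOnModule T M) →
      MaxRank.weights (MaxRank.torusOnModule T M) ⊆ MaxRank.weights (MaxRank.torusOnN T) →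
      MaxRank.invariantCohomology T M s = ⊥) ∧
    ((∀ i ≤ s - 1, Subsingleton (MaxRank.Cohomology
        (LieModule.toEnd ℂ (MaxRank.Extension T) (MaxRank.Extension T)) i)) →
      (∀ j, MaxRank.invariantCohomology T (MaxRank.Extension T) j = ⊥) ∧
      ∀ n, Subsingleton (MaxRank.Cohomology
        (LieModule.toEnd ℂ (MaxRank.Extension T) (MaxRank.Extension T)) n)) := by
  have hTor : MaxRank.IsTorus T := hT.prop
  obtain ⟨m, rfl⟩ := Nat.exists_eq_add_of_le' hs
  have hlcs : LieModule.lowerCentralSeries ℂ N N (m + 2) = ⊥ :=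
    ((LieModule.nilpotencyLength_eq_succ_iff ℂ N N (m + 1)).1 (Nat.succ_injective hnil)).1
  obtain ⟨n, e, α, hgen⟩ := hTor.exists_isWeightGenerating hrank hlcs
  refine ⟨fun M _ _ _ _ _ hdiag hW => ?_, fun hvan => ?_⟩
  · have hM := MaxRank.isSemisimple_of_actsDiagonally hdiag
    rw [MaxRank.invariantCohomology_eq_bot_iff hTor hM]
    exact fun f _ hf => hgen.mem_coboundaries hTor (fun μ hμ => Or.inr (hW hμ)) hM hlcs hf
  · have hM := hTor.isSemisimple_adjoint
    have hW := fun μ => hTor.weights_adjoint (μ := μ)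
    have hall : ∀ j, MaxRank.invariantCohomology T (MaxRank.Extension T) j = ⊥ := fun j => by
      rw [MaxRank.invariantCohomology_eq_bot_iff hTor hM]
      intro f hf hinv
      rcases lt_trichotomy j (m + 2) with hj | rfl | hj
      · exact MaxRank.invariant_cocycle_mem_coboundaries
          ((MaxRank.subsingleton_cohomology_iff _ j).1 (hvan j (by omega))) f hf hinv
      · exact hgen.mem_coboundaries hTor hW hM hlcs hinv
      · rw [hgen.eq_zero_of_lt hTor hW hlcs hj hinv]
        exact Submodule.zero_mem _
    exact ⟨hall, MaxRank.subsingleton_cohomology_extension hTor hM hall⟩
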